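/- Let $n\ge 2$ and let $Q\subset\mathbb{R}^2$ be a convex $(n+3)$-gon with vertices $p_1,\dots,p_{n+3}$, labelled in cyclic (counterclockwise) order. For a triangulation $t$ of $Q$ without new vertices, its GKZ vector $v(t)\in\mathbb{R}^{n+3}$ has as its $i$-th coordinate the sum of the areas of the triangles of $t$ that have $p_i$ as a vertex. The secondary polytope $\Sigma(Q)\subset\mathbb{R}^{n+3}$ is the convex hull of the vectors $v(t)$, where $t$ ranges over all triangulations of $Q$. A facet is a nonempty face of dimension $\dim\Sigma(Q)-1$, and two facets are parallel if their affine hulls are parallel, that is, have the same direction space. For a diagonal $\delta$ of $Q$ let $F_\delta$ be the convex hull of the vectors $v(t)$ of the triangulations $t$ that contain $\delta$, and let $V_\delta=\operatorname{span}\{x-y : x,y\in F_\delta\}$ be its direction space. Then: 1. No two distinct facets of $\Sigma(Q)$ are parallel. 2. The map $\delta\mapsto F_\delta$ is a bijection from the set of diagonals of $Q$ to the set of facets of $\Sigma(Q)$. 3. If $\delta\ne\delta'$ are diagonals that do not cross (they do not intersect in an interior point of $Q$), then $F_\delta\cap F_{\delta'}\ne\emptyset$. 4. If $\delta\neq\delta'$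 are diagonals that cross, then there are two triangulations $t$ and $t_1$ of $Q$, both containing $\delta'$, such that $t_1$ is obtained from $t$ by flipping one diagonal (replacing it by the other diagonal of the quadrilateral formed by the two triangles of $t$ that contain it), and $v(t_1)-v(t)\in V_{\delta'}$ but $v(t_1)-v(t)\notin V_\delta$. -/

import Mathlib

noncomputable section

namespace SecondaryPolytope

open MeasureTheory

variable {ι : Type*} [DecidableEq ι] {d : ℕ}

/-- The convex hull of the points `p i`, `i ∈ σ`. -/
def hull (p : ι → EuclideanSpace ℝ (Fin d)) (σ : Finset ι) : Set (EuclideanSpace ℝ (Fin d)) :=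
  convexHull ℝ (p '' (σ : Set ι))

/-- `t` (a finite set of simplices of full dimension, each given by the set of labels of its
vertices) is a triangulation, without new vertices, of the polytope with vertices `p i`: the
simplices cover the polytope, and any two of them meet in the common face that is spanned by
their common vertices. -/
structure IsTriangulation (p : ι → EuclideanSpace ℝ (Fin d)) (t : Finset (Finset ι)) : Prop where
  card_eq : ∀ σ ∈ t, σ.card = d + 1
  affineIndependent : ∀ σ ∈ t, AffineIndependent ℝ (fun i : σ => p i)
  cover : (⋃ σ ∈ t, hull p σ) = convexHull ℝ (Set.range p)
  inter_eq : ∀ σ ∈ t, ∀ τ ∈ t, hull p σ ∩ hull p τ = hull p (σ ∩ τ)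

/-- The GKZ vector of `t`: its `i`-th coordinate is the sum of the volumes of the simplices of
`t` that have `i` as a vertex. -/
def gkz (p : ι → EuclideanSpace ℝ (Fin d)) (t : Finset (Finset ι)) : ι → ℝ :=
  fun i => ∑ σ ∈ t with i ∈ σ, volume.real (hull p σ)

/-- The secondary polytope of the polytope with vertices `p i`: the convex hull of the GKZ vectors
of all its triangulations. -/
def secondaryPolytope (p : ι → EuclideanSpace ℝ (Fin d)) : Set (ι → ℝ) :=
  convexHull ℝ {x | ∃ t, IsTriangulation p t ∧ gkz p t = x}

/-- `F` is a facet of the polytope `P`: a nonempty face (the set of maximizers on `P` of a linear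
functional) whose dimension is one less than the dimension of `P`. -/
structure IsFacet {E : Type*} [AddCommGroup E] [Module ℝ E] [TopologicalSpace E]
    (P F : Set E) : Prop where
  isExposed : IsExposed ℝ P F
  nonempty : F.Nonempty
  finrank_add_one : Module.finrank ℝ (vectorSpan ℝ F) + 1 = Module.finrank ℝ (vectorSpan ℝ P)

/-- The points `p 0, p 1, …, p (m - 1)` are the vertices of a (strictly) convex `m`-gon in the
plane, listed counterclockwise: for `i < j < k` the triangle `p i, p j, p k` is nondegenerate and
positively oriented. -/
def IsConvexPolygon {m : ℕ} (p : Fin m → EuclideanSpace ℝ (Fin 2)) : Prop :=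
  ∀ i j k : Fin m, i < j → j < k →
    0 < (p j 0 - p i 0) * (p k 1 - p i 1) - (p j 1 - p i 1) * (p k 0 - p i 0)

/-- A diagonal of an `(n + 3)`-gon: a pair of distinct vertices that is not a side
`{i, i + 1}` (indices modulo `n + 3`). -/
def IsDiagonal {n : ℕ} (δ : Finset (Fin (n + 3))) : Prop :=
  δ.card = 2 ∧ ∀ i : Fin (n + 3), δ ≠ {i, i + 1}

/-- The segments `δ` and `δ'` intersect in an interior point of the polygon. -/
def Crosses (p : ι → EuclideanSpace ℝ (Fin 2)) (δ δ' : Finset ι) : Prop :=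
  (hull p δ ∩ hull p δ' ∩ interior (convexHull ℝ (Set.range p))).Nonempty

/-- `δ` is a face (for a pair of labels: an edge) of the triangulation `t`. -/
def HasFace (t : Finset (Finset ι)) (δ : Finset ι) : Prop :=
  ∃ σ ∈ t, δ ⊆ σ

/-- The face `F_δ` of the secondary polytope that corresponds to `δ`: the convex hull of the GKZ
vectors of the triangulations that contain `δ`. -/
def diagonalFace (p : ι → EuclideanSpace ℝ (Fin d)) (δ : Finset ι) : Set (ι → ℝ) :=
  convexHull ℝ {x | ∃ t, IsTriangulation p t ∧ HasFace t δ ∧ gkz p t = x}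

/-- `t'` is obtained from the triangulation `t` of a polygon by a flip: the diagonal `{a, c}`,
common to the triangles `{a, b, c}` and `{a, c, d}` of `t`, is replaced by the other diagonal
`{b, d}` of the quadrilateral formed by these two triangles. -/
def IsFlip (p : ι → EuclideanSpace ℝ (Fin 2)) (t t' : Finset (Finset ι)) : Prop :=
  IsTriangulation p t ∧ IsTriangulation p t' ∧
    ∃ a b c d : ι, {a, b, c} ∈ t ∧ {a, c, d} ∈ t ∧
      t' = (t \ {{a, b, c}, {a, c, d}}) ∪ {{a, b, d}, {b, c, d}}

end SecondaryPolytope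

end

/-! Pairing a vector `ω` with `gkz p t` gives three times the integral over the polygon of the
function that interpolates `ω` linearly on each triangle of `t`; this number is `cellSum p ω t`. For
a diagonal take as `ω` its fold, the values at the vertices of the positive part of an affine
function vanishing on the line of the diagonal. The positive part is convex, so every interpolation
lies above it, and the integrals agree exactly when no triangle has vertices strictly on both sides
of the line, that is, when `t` contains the diagonal. Hence `F_δ` is the face on which the fold of
`δ` is minimal (`exists_cellSum_fold`, `diagonalFace_eq`). No integral is computed: the integral
over a triangle is a signed sum of terms attached to its edges, and the terms of inner edges cancel
(`cellSum_bound`).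

The folds along the diagonals of one triangulation `t`, together with the affine functions, span all
functions on the vertices (`exists_eq_affine_add_sum_fold`), and affine functions pair to a constant
with all GKZ vectors. Flipping one diagonal of `t` keeps the others, so it changes the value of `ω`
by a positive multiple of the coefficient of that diagonal alone (`exists_isFlip_cellSum`). Flips
therefore read off coefficients. A functional constant on `F_δ` is a multiple of the fold of `δ` up
to a constant on the polytope, so `V_δ` is a hyperplane in the direction space of the polytope and
`F_δ` is a facet. A functional minimal at `t` has nonnegative coefficients; if it is not constant,
one is positive, and all minimizers contain the corresponding diagonal. So every facet lies in some
`F_δ`, and equals it by dimension.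

If `δ` and `δ'` do not cross, some triangulation contains both; flipping `δ'` there stays in `F_δ`
but leaves `V_δ'`. If they cross and every flip of some `t` containing `δ'` that keeps `δ'` also
kept the value of the fold of `δ`, this fold would be affine plus a multiple of the fold of `δ'`; a
fifth vertex, hence `n ≥ 2`, excludes that (`not_fold_eq_affine_add_fold`).

The combinatorics is done on the recursive description `PolyTri`, which `isTriangulation_iff`
identifies with the geometric one. -/

noncomputable section

namespace SecondaryPolytope

open MeasureTheory

/-! ### Orientation of three points -/

/-- Twice the signed area of the triangle `a, b, c`. -/
def orient (a b c : EuclideanSpace ℝ (Fin 2)) : ℝ :=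
  (b 0 - a 0) * (c 1 - a 1) - (b 1 - a 1) * (c 0 - a 0)

theorem orient_rotate (a b c : EuclideanSpace ℝ (Fin 2)) : orient b c a = orient a b c := by
  unfold orient; ring

theorem orient_swap (a b c : EuclideanSpace ℝ (Fin 2)) : orient a c b = -orient a b c := by
  unfold orient; ring

@[simp] theorem orient_self_left (a b : EuclideanSpace ℝ (Fin 2)) : orient a a b = 0 := by
  unfold orient; ring

@[simp] theorem orient_self_right (a b : EuclideanSpace ℝ (Fin 2)) : orient a b b = 0 := by
  unfold orient; ring

@[simp] theorem orient_self_outer (a b : EuclideanSpace ℝ (Fin 2)) : orient a b a = 0 := by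
  unfold orient; ring

/-! ### Convex hulls of labelled points -/

section Hull

variable {ι : Type*} {d : ℕ} {p : ι → EuclideanSpace ℝ (Fin d)} {σ τ : Finset ι}

theorem hull_mono (h : σ ⊆ τ) : hull p σ ⊆ hull p τ :=
  convexHull_mono (Set.image_mono (by exact_mod_cast h))

theorem mem_hull_of_mem {i : ι} (h : i ∈ σ) : p i ∈ hull p σ :=
  subset_convexHull ℝ _ ⟨i, by exact_mod_cast h, rfl⟩

theorem convex_hull (σ : Finset ι) : Convex ℝ (hull p σ) := convex_convexHull ℝ _

theorem mem_hull_iff {x : EuclideanSpace ℝ (Fin d)} :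
    x ∈ hull p σ ↔
      ∃ w : ι → ℝ, (∀ i ∈ σ, 0 ≤ w i) ∧ ∑ i ∈ σ, w i = 1 ∧ ∑ i ∈ σ, w i • p i = x := by
  classical
  constructor
  · intro hx
    have hconv : Convex ℝ {x | ∃ w : ι → ℝ, (∀ i ∈ σ, 0 ≤ w i) ∧ ∑ i ∈ σ, w i = 1 ∧
        ∑ i ∈ σ, w i • p i = x} := by
      rintro x ⟨w, hw, hw1, rfl⟩ y ⟨v, hv, hv1, rfl⟩ a b ha hb hab
      refine ⟨fun i => a * w i + b * v i, fun i hi => ?_, ?_, ?_⟩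
      · have := hw i hi
        have := hv i hi
        positivity
      · rw [Finset.sum_add_distrib, ← Finset.mul_sum, ← Finset.mul_sum, hw1, hv1]
        linarith
      · simp only [add_smul, mul_smul, Finset.sum_add_distrib, Finset.smul_sum]
    refine convexHull_min ?_ hconv hx
    rintro _ ⟨i, hi, rfl⟩
    refine ⟨fun j => if j = i then 1 else 0, fun j _ => ?_, ?_, ?_⟩
    · dsimp only
      split_ifs <;> norm_num
    · simpa using hi
    · simp only [ite_smul, one_smul, zero_smul, Finset.sum_ite_eq', if_pos (Finset.mem_coe.1 hi)]
  · rintro ⟨w, hw, hw1, rfl⟩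
    exact (convex_hull σ).sum_mem hw hw1 fun i hi => mem_hull_of_mem hi

theorem hull_singleton (i : ι) : hull p {i} = {p i} := by simp [hull]

theorem hull_empty : hull p ∅ = ∅ := by simp [hull]

theorem isClosed_hull (σ : Finset ι) : IsClosed (hull p σ) :=
  (σ.finite_toSet.image p).isClosed_convexHull ℝ

end Hull

/-! ### Affine functions on the plane -/

/-- An affine function on the plane. -/
structure IsAffineFun (f : EuclideanSpace ℝ (Fin 2) → ℝ) : Prop where
  exists_coeff : ∃ α β γ : ℝ, ∀ x, f x = α + β * x 0 + γ * x 1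

namespace IsAffineFun

variable {f g : EuclideanSpace ℝ (Fin 2) → ℝ}

theorem orient_middle (a b : EuclideanSpace ℝ (Fin 2)) : IsAffineFun fun x => orient a x b :=
  ⟨⟨a 1 * (b 0 - a 0) - a 0 * (b 1 - a 1), b 1 - a 1, -(b 0 - a 0), fun x => by
    unfold orient; ring⟩⟩

theorem add (hf : IsAffineFun f) (hg : IsAffineFun g) : IsAffineFun fun x => f x + g x := by
  obtain ⟨α, β, γ, h⟩ := hf
  obtain ⟨α', β', γ', h'⟩ := hg
  exact ⟨α + α', β + β', γ + γ', fun x => by rw [h, h']; ring⟩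

theorem const_mul (hf : IsAffineFun f) (c : ℝ) : IsAffineFun fun x => c * f x := by
  obtain ⟨α, β, γ, h⟩ := hf
  exact ⟨c * α, c * β, c * γ, fun x => by rw [h]; ring⟩

theorem sub (hf : IsAffineFun f) (hg : IsAffineFun g) : IsAffineFun fun x => f x - g x := by
  simpa [sub_eq_add_neg] using hf.add (hg.const_mul (-1))

theorem neg (hf : IsAffineFun f) : IsAffineFun fun x => - f x := by
  simpa using hf.const_mul (-1)

theorem sum_eq (hf : IsAffineFun f) {ι : Type*} (s : Finset ι) (w : ι → ℝ)
    (p : ι → EuclideanSpace ℝ (Fin 2)) (hw : ∑ i ∈ s, w i = 1) :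
    f (∑ i ∈ s, w i • p i) = ∑ i ∈ s, w i * f (p i) := by
  obtain ⟨α, β, γ, h⟩ := hf
  simp only [h, mul_add, Finset.sum_add_distrib, ← Finset.sum_mul, hw]
  simp only [WithLp.ofLp_sum, Finset.sum_apply, PiLp.smul_apply, smul_eq_mul, Finset.mul_sum,
    one_mul]
  congr 1
  · congr 1
    exact Finset.sum_congr rfl fun i _ => by ring
  · exact Finset.sum_congr rfl fun i _ => by ring

theorem combo (hf : IsAffineFun f) {a b : ℝ} (hab : a + b = 1) (x y : EuclideanSpace ℝ (Fin 2)) :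
    f (a • x + b • y) = a * f x + b * f y := by
  obtain ⟨α, β, γ, h⟩ := hf
  simp only [h, PiLp.add_apply, PiLp.smul_apply, smul_eq_mul]
  linear_combination (-α) * hab

theorem eq_zero_of_three (hf : IsAffineFun f) {a b c : EuclideanSpace ℝ (Fin 2)}
    (h : orient a b c ≠ 0) (ha : f a = 0) (hb : f b = 0) (hc : f c = 0)
    (x : EuclideanSpace ℝ (Fin 2)) : f x = 0 := by
  obtain ⟨α, β, γ, hf⟩ := hf
  rw [hf] at ha hb hc ⊢
  have hβ : β * orient a b c = 0 := by
    unfold orient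
    linear_combination (c 1 - a 1) * (hb - ha) - (b 1 - a 1) * (hc - ha)
  have hγ : γ * orient a b c = 0 := by
    unfold orient
    linear_combination (b 0 - a 0) * (hc - ha) - (c 0 - a 0) * (hb - ha)
  have hβ' := (mul_eq_zero.1 hβ).resolve_right h
  have hγ' := (mul_eq_zero.1 hγ).resolve_right h
  subst hβ' hγ'
  linarith

theorem exists_eq_on_pair {a b : EuclideanSpace ℝ (Fin 2)} (h : a ≠ b) (u v : ℝ) :
    ∃ f, IsAffineFun f ∧ f a = u ∧ f b = v := by
  have hpos : (b 0 - a 0) ^ 2 + (b 1 - a 1) ^ 2 ≠ 0 := by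
    intro h0
    have h1 : b 0 - a 0 = 0 := by nlinarith [sq_nonneg (b 0 - a 0), sq_nonneg (b 1 - a 1)]
    have h2 : b 1 - a 1 = 0 := by nlinarith [sq_nonneg (b 0 - a 0), sq_nonneg (b 1 - a 1)]
    apply h
    ext i
    fin_cases i <;> simp <;> linarith
  set N := (b 0 - a 0) ^ 2 + (b 1 - a 1) ^ 2 with hN
  refine ⟨fun x => u + (v - u) / N * ((b 0 - a 0) * (x 0 - a 0) + (b 1 - a 1) * (x 1 - a 1)),
    ⟨u - (v - u) / N * ((b 0 - a 0) * a 0 + (b 1 - a 1) * a 1), (v - u) / N * (b 0 - a 0),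
      (v - u) / N * (b 1 - a 1), fun x => by ring⟩, by simp, ?_⟩
  have : (b 0 - a 0) * (b 0 - a 0) + (b 1 - a 1) * (b 1 - a 1) = N := by rw [hN]; ring
  simp only [this]
  field_simp
  ring

variable {ι : Type*} {p : ι → EuclideanSpace ℝ (Fin 2)} {σ : Finset ι}
  {x : EuclideanSpace ℝ (Fin 2)}

theorem nonneg_of_mem_hull (hf : IsAffineFun f) (h : ∀ i ∈ σ, 0 ≤ f (p i)) (hx : x ∈ hull p σ) :
    0 ≤ f x := by
  obtain ⟨w, hw, hw1, rfl⟩ := mem_hull_iff.1 hx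
  rw [hf.sum_eq _ _ _ hw1]
  exact Finset.sum_nonneg fun i hi => mul_nonneg (hw i hi) (h i hi)

theorem nonpos_of_mem_hull (hf : IsAffineFun f) (h : ∀ i ∈ σ, f (p i) ≤ 0) (hx : x ∈ hull p σ) :
    f x ≤ 0 := by
  have := hf.neg.nonneg_of_mem_hull (fun i hi => neg_nonneg.2 (h i hi)) hx
  linarith

/-- A nonnegative affine function that vanishes at a point of the hull vanishes on the vertices
that span it. -/
theorem mem_hull_of_eq_zero (hf : IsAffineFun f) (h : ∀ i ∈ σ, 0 ≤ f (p i)) (hx : x ∈ hull p σ)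
    (h0 : f x = 0) {τ : Finset ι} (hτ : ∀ i ∈ σ, f (p i) = 0 → i ∈ τ) (hτσ : τ ⊆ σ) :
    x ∈ hull p τ := by
  obtain ⟨w, hw, hw1, rfl⟩ := mem_hull_iff.1 hx
  rw [hf.sum_eq _ _ _ hw1,
    Finset.sum_eq_zero_iff_of_nonneg fun i hi => mul_nonneg (hw i hi) (h i hi)] at h0
  have hz : ∀ i ∈ σ, i ∉ τ → w i = 0 := fun i hi hiτ =>
    (mul_eq_zero.1 (h0 i hi)).resolve_right fun h => hiτ (hτ i hi h)
  refine mem_hull_iff.2 ⟨w, fun i hi => hw i (hτσ hi), ?_, ?_⟩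
  · rw [← hw1]
    exact Finset.sum_subset hτσ hz
  · exact Finset.sum_subset hτσ fun i hi hiτ => by rw [hz i hi hiτ, zero_smul]

theorem mem_hull_of_eq_zero' (hf : IsAffineFun f) (h : ∀ i ∈ σ, f (p i) ≤ 0) (hx : x ∈ hull p σ)
    (h0 : f x = 0) {τ : Finset ι} (hτ : ∀ i ∈ σ, f (p i) = 0 → i ∈ τ) (hτσ : τ ⊆ σ) :
    x ∈ hull p τ :=
  hf.neg.mem_hull_of_eq_zero (fun i hi => neg_nonneg.2 (h i hi)) hx (by simp [h0])
    (fun i hi h => hτ i hi (by simpa using h)) hτσ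

/-- If a convex set contains `y` and every zero of an affine function `f` on the segment `[y, z]`,
then it contains the part of the segment on the side of `y`. -/
theorem mem_of_mem_segment (hf : IsAffineFun f) {A : Set (EuclideanSpace ℝ (Fin 2))}
    (hA : Convex ℝ A) {y z : EuclideanSpace ℝ (Fin 2)} (hy : y ∈ A) (hz : f z ≤ 0)
    (hx : x ∈ segment ℝ y z) (hfx : 0 ≤ f x) (hcut : ∀ w ∈ segment ℝ y z, f w = 0 → w ∈ A) :
    x ∈ A := by
  rcases hz.eq_or_lt with hz0 | hz0
  · exact hA.segment_subset hy (hcut z (right_mem_segment ℝ y z) hz0) hx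
  obtain ⟨a, b, ha, hb, hab, rfl⟩ := hx
  rw [hf.combo hab] at hfx
  rcases hb.eq_or_lt with rfl | hb0
  · have : a = 1 := by linarith
    simpa [this] using hy
  have hfy : 0 < f y := by
    by_contra hcon
    nlinarith [mul_nonneg ha (neg_nonneg.2 (not_lt.1 hcon)), mul_pos hb0 (neg_pos.2 hz0)]
  have hd : 0 < f y - f z := by linarith
  -- This is the zero of `f` on the segment; `x` lies between it and `y`.
  have hw : (-f z / (f y - f z)) • y + (f y / (f y - f z)) • z ∈ A := by
    have h1 : -f z / (f y - f z) + f y / (f y - f z) = 1 := by field_simp; ring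
    refine hcut _ ⟨_, _, div_nonneg (by linarith) hd.le, div_nonneg hfy.le hd.le, h1, rfl⟩ ?_
    rw [hf.combo h1]
    field_simp
    ring
  have hc : 0 ≤ (a * f y + b * f z) / f y := div_nonneg hfx hfy.le
  have he : 0 ≤ b * (f y - f z) / f y := by positivity
  convert hA hy hw hc he (by field_simp; linear_combination (f y) * hab) using 1
  rw [smul_add, smul_smul, smul_smul, ← add_assoc, ← add_smul]
  congr 2
  · field_simp
    ring
  · field_simp

end IsAffineFun

/-- Applying to an affine dependence a function that is nonzero at one point only isolates the
weight of that point. -/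
theorem affineIndependent_of_forall_exists {ι : Type*} {p : ι → EuclideanSpace ℝ (Fin 2)}
    (h : ∀ i, ∃ f, IsAffineFun f ∧ f (p i) ≠ 0 ∧ ∀ j, j ≠ i → f (p j) = 0) :
    AffineIndependent ℝ p := by
  rw [affineIndependent_iff]
  intro s w hw hwp i hi
  obtain ⟨f, ⟨α, β, γ, hf⟩, hfi, hfj⟩ := h i
  have h0 : ∑ j ∈ s, w j * f (p j) = 0 := by
    have e0 := congrArg (fun x : EuclideanSpace ℝ (Fin 2) => x 0) hwp
    have e1 := congrArg (fun x : EuclideanSpace ℝ (Fin 2) => x 1) hwp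
    simp only [WithLp.ofLp_sum, Finset.sum_apply, PiLp.smul_apply, smul_eq_mul,
      PiLp.zero_apply] at e0 e1
    have : ∑ j ∈ s, w j * f (p j) =
        α * ∑ j ∈ s, w j + β * ∑ j ∈ s, w j * p j 0 + γ * ∑ j ∈ s, w j * p j 1 := by
      simp only [Finset.mul_sum, ← Finset.sum_add_distrib]
      exact Finset.sum_congr rfl fun j _ => by rw [hf]; ring
    rw [this, hw, e0, e1]
    ring
  rw [Finset.sum_eq_single_of_mem i hi fun j _ hj => by rw [hfj j hj, mul_zero]] at h0
  exact (mul_eq_zero.1 h0).resolve_right hfi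

/-! ### Areas of triangles -/

section Volume

/-- The standard triangle. -/
def stdTriangle : Set (EuclideanSpace ℝ (Fin 2)) := convexHull ℝ {0, !₂[1, 0], !₂[0, 1]}

theorem volume_stdTriangle_pos : 0 < volume.real stdTriangle := by
  have hb : Bornology.IsBounded stdTriangle :=
    isBounded_convexHull.2 (Set.toFinite _).isBounded
  refine ENNReal.toReal_pos (ne_of_gt ?_) hb.measure_lt_top.ne
  have hopen : IsOpen {x : EuclideanSpace ℝ (Fin 2) | 0 < x 0 ∧ 0 < x 1 ∧ x 0 + x 1 < 1} := by
    refine IsOpen.and (isOpen_lt ?_ ?_) (IsOpen.and (isOpen_lt ?_ ?_) (isOpen_lt ?_ ?_)) <;>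
      fun_prop
  refine (hopen.measure_pos volume ⟨!₂[1 / 3, 1 / 3], by norm_num⟩).trans_le (measure_mono ?_)
  rintro x ⟨h0, h1, h2⟩
  have hz : (0 : EuclideanSpace ℝ (Fin 2)) ∈ stdTriangle := subset_convexHull ℝ _ (by simp)
  have he0 : !₂[1, 0] ∈ stdTriangle := subset_convexHull ℝ _ (by simp)
  have he1 : !₂[0, 1] ∈ stdTriangle := subset_convexHull ℝ _ (by simp)
  have := (convex_convexHull ℝ ({0, !₂[1, 0], !₂[0, 1]} : Set (EuclideanSpace ℝ (Fin 2)))).sum_mem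
    (t := Finset.univ) (w := ![1 - x 0 - x 1, x 0, x 1]) (z := ![0, !₂[1, 0], !₂[0, 1]])
    (by intro i _; fin_cases i <;> simp <;> linarith)
    (by simp only [Fin.sum_univ_three, Matrix.cons_val]; ring)
    (by intro i _; fin_cases i; exacts [hz, he0, he1])
  have hx : ∑ i, (![1 - x 0 - x 1, x 0, x 1] : Fin 3 → ℝ) i •
      (![0, !₂[1, 0], !₂[0, 1]] : Fin 3 → EuclideanSpace ℝ (Fin 2)) i = x := by
    ext i
    fin_cases i <;> simp [Fin.sum_univ_three]
  rwa [hx] at this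

/-- The triangle is the image of the standard one under an affine map with determinant `orient a b
c`. The area of the standard triangle is a common factor throughout, so its positivity suffices and
its value is never needed. -/
theorem volume_convexHull_triangle (a b c : EuclideanSpace ℝ (Fin 2)) :
    volume.real (convexHull ℝ {a, b, c}) = volume.real stdTriangle * |orient a b c| := by
  set M : Matrix (Fin 2) (Fin 2) ℝ := !![b 0 - a 0, c 0 - a 0; b 1 - a 1, c 1 - a 1] with hM
  set f : EuclideanSpace ℝ (Fin 2) →ₗ[ℝ] EuclideanSpace ℝ (Fin 2) := Matrix.toLpLin 2 2 M with hf
  have hdet : LinearMap.det f = orient a b c := by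
    rw [hf, LinearMap.det_toLpLin, hM, Matrix.det_fin_two_of]
    unfold orient
    ring
  have himg : convexHull ℝ {a, b, c} = (fun x => a + x) '' (f '' stdTriangle) := by
    have h1 : f '' stdTriangle = convexHull ℝ (f '' {0, !₂[1, 0], !₂[0, 1]}) :=
      f.image_convexHull _
    have h2 : (fun x => a + x) '' (convexHull ℝ (f '' {0, !₂[1, 0], !₂[0, 1]})) =
        convexHull ℝ ((fun x => a + x) '' (f '' {0, !₂[1, 0], !₂[0, 1]})) := by
      have := convexHull_vadd (𝕜 := ℝ) a (f '' {0, !₂[1, 0], !₂[0, 1]})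
      exact this.symm
    rw [h1, h2]
    congr 1
    simp only [Set.image_insert_eq, Set.image_singleton, map_zero, add_zero]
    have hb : a + f !₂[1, 0] = b := by
      ext i
      fin_cases i <;> simp [hf, hM, Matrix.vecHead]
    have hc : a + f !₂[0, 1] = c := by
      ext i
      fin_cases i <;> simp [hf, hM, Matrix.vecHead, Matrix.vecTail]
    rw [hb, hc]
  rw [himg, measureReal_def, measureReal_def, Set.image_add_left, measure_preimage_add,
    Measure.addHaar_image_linearMap, hdet, ENNReal.toReal_mul,
    ENNReal.toReal_ofReal (abs_nonneg _), mul_comm]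

end Volume

/-! ### Chords of a convex polygon -/

theorem exists_of_orient_eq_zero {a b x : EuclideanSpace ℝ (Fin 2)} (hab : a ≠ b)
    (h : orient a x b = 0) : ∃ s : ℝ, x = (1 - s) • a + s • b := by
  unfold orient at h
  by_cases h0 : b 0 - a 0 = 0
  · have h1 : b 1 - a 1 ≠ 0 := fun h1 => hab <| by
      ext i
      fin_cases i <;> simp <;> linarith
    refine ⟨(x 1 - a 1) / (b 1 - a 1), ?_⟩
    ext i
    fin_cases i
    · simp only [PiLp.add_apply, PiLp.smul_apply, smul_eq_mul, Fin.zero_eta]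
      field_simp
      linear_combination h
    · simp only [PiLp.add_apply, PiLp.smul_apply, smul_eq_mul, Fin.mk_one]
      field_simp
      ring
  · refine ⟨(x 0 - a 0) / (b 0 - a 0), ?_⟩
    ext i
    fin_cases i
    · simp only [PiLp.add_apply, PiLp.smul_apply, smul_eq_mul, Fin.zero_eta]
      field_simp
      ring
    · simp only [PiLp.add_apply, PiLp.smul_apply, smul_eq_mul, Fin.mk_one]
      field_simp
      linear_combination -h

theorem hull_pair {ι : Type*} [DecidableEq ι] {d : ℕ} (p : ι → EuclideanSpace ℝ (Fin d))
    (i k : ι) : hull p {i, k} = segment ℝ (p i) (p k) := by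
  simp [hull, Set.image_pair, convexHull_pair]

theorem hull_univ {ι : Type*} [Fintype ι] {d : ℕ} (p : ι → EuclideanSpace ℝ (Fin d)) :
    hull p Finset.univ = convexHull ℝ (Set.range p) := by
  simp [hull]

namespace IsConvexPolygon

variable {n : ℕ} {p : Fin (n + 3) → EuclideanSpace ℝ (Fin 2)}

theorem orient_pos (hp : IsConvexPolygon p) {i j k : Fin (n + 3)} (hij : i < j) (hjk : j < k) :
    0 < orient (p i) (p j) (p k) := hp i j k hij hjk

theorem orient_neg (hp : IsConvexPolygon p) {i j k : Fin (n + 3)} (hik : i < k)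
    (h : j < i ∨ k < j) : orient (p i) (p j) (p k) < 0 := by
  rw [orient_swap, neg_lt_zero]
  rcases h with h | h
  · rw [orient_rotate]
    exact hp.orient_pos h hik
  · exact hp.orient_pos hik h

theorem orient_ne_zero (hp : IsConvexPolygon p) {i j k : Fin (n + 3)} (hij : i ≠ j) (hjk : j ≠ k)
    (hik : i ≠ k) : orient (p i) (p j) (p k) ≠ 0 := by
  have key : ∀ {i j k : Fin (n + 3)}, i < k → i ≠ j → j ≠ k → orient (p i) (p j) (p k) ≠ 0 := by
    intro i j k hik hij hjk
    rcases lt_or_gt_of_ne hij with h | h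
    · rcases lt_or_gt_of_ne hjk with h' | h'
      · exact (hp.orient_pos h h').ne'
      · exact (hp.orient_neg hik (Or.inr h')).ne
    · exact (hp.orient_neg hik (Or.inl h)).ne
  rcases lt_or_gt_of_ne hik with h | h
  · exact key h hij hjk
  · have h' := key h hjk.symm hij.symm
    rwa [← orient_rotate, orient_swap, neg_ne_zero, orient_rotate] at h'

theorem orient_nonneg (hp : IsConvexPolygon p) {i j k : Fin (n + 3)} (hij : i ≤ j) (hjk : j ≤ k) :
    0 ≤ orient (p i) (p j) (p k) := by
  rcases hij.eq_or_lt with rfl | h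
  · simp
  · rcases hjk.eq_or_lt with rfl | h'
    · simp
    · exact (hp.orient_pos h h').le

theorem orient_nonpos (hp : IsConvexPolygon p) {i j k : Fin (n + 3)} (hik : i < k)
    (h : ¬(i < j ∧ j < k)) : orient (p i) (p j) (p k) ≤ 0 := by
  by_cases hij : i = j
  · simp [hij]
  · by_cases hjk : j = k
    · simp [hjk]
    · exact (hp.orient_neg hik (by grind)).le

theorem injective (hp : IsConvexPolygon p) : Function.Injective p := by
  intro i j hij
  by_contra hne
  have : ∃ k : Fin (n + 3), k ∉ ({i, j} : Finset (Fin (n + 3))) := by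
    by_contra! hcon
    have h1 : Finset.univ ⊆ ({i, j} : Finset (Fin (n + 3))) := fun k _ => hcon k
    have h2 := (Finset.card_le_card h1).trans Finset.card_le_two
    simp at h2
  obtain ⟨k, hk⟩ := this
  simp only [Finset.mem_insert, Finset.mem_singleton, not_or] at hk
  exact hp.orient_ne_zero hne (Ne.symm hk.2) (Ne.symm hk.1) (by rw [hij]; simp)

/-- The line through two vertices meets the polygon in the segment between them. -/
theorem mem_hull_pair_of_orient_eq_zero (hp : IsConvexPolygon p) {i k : Fin (n + 3)} (hik : i < k)
    {x : EuclideanSpace ℝ (Fin 2)} (hx : x ∈ hull p Finset.univ)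
    (h0 : orient (p i) x (p k) = 0) : x ∈ hull p {i, k} := by
  by_cases hcov : i ⋖ k
  · refine (IsAffineFun.orient_middle (p i) (p k)).mem_hull_of_eq_zero'
      (fun j _ => hp.orient_nonpos hik fun h => hcov.2 h.1 h.2) hx h0 (fun j _ hj => ?_)
      (Finset.subset_univ _)
    by_contra hjn
    simp only [Finset.mem_insert, Finset.mem_singleton, not_or] at hjn
    exact hp.orient_ne_zero (Ne.symm hjn.1) hjn.2 hik.ne hj
  · have hmid : ∃ u, i < u ∧ u < k := by
      by_contra! hcon
      exact hcov ⟨hik, fun c hc hc' => (hcon c hc).not_gt hc'⟩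
    obtain ⟨u, hiu, huk⟩ := hmid
    -- The sides `{i, v}` and `{w, k}` support the polygon; they bound the parameter `s` of a point
    -- on the line from below by 0 and from above by 1.
    obtain ⟨v, hv, hvu⟩ := exists_covBy_le_of_lt hiu
    obtain ⟨w, huw, hw⟩ := exists_le_covBy_of_lt huk
    have h1 : orient (p i) x (p v) ≤ 0 :=
      (IsAffineFun.orient_middle (p i) (p v)).nonpos_of_mem_hull
        (fun j _ => hp.orient_nonpos hv.1 fun h => hv.2 h.1 h.2) hx
    have h2 : orient (p w) x (p k) ≤ 0 :=
      (IsAffineFun.orient_middle (p w) (p k)).nonpos_of_mem_hull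
        (fun j _ => hp.orient_nonpos hw.1 fun h => hw.2 h.1 h.2) hx
    obtain ⟨s, rfl⟩ := exists_of_orient_eq_zero (hp.injective.ne hik.ne) h0
    rw [(IsAffineFun.orient_middle _ _).combo (by ring)] at h1 h2
    rw [orient_self_left, mul_zero, zero_add] at h1
    rw [orient_self_right, mul_zero, add_zero] at h2
    have h3 := hp.orient_neg hv.1 (Or.inr (hvu.trans_lt huk))
    have h4 := hp.orient_neg hw.1 (Or.inl (hiu.trans_le huw))
    rw [hull_pair]
    exact ⟨1 - s, s, by nlinarith, by nlinarith, by ring, rfl⟩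

/-- If an end point is missing from `B`, the affine function that is 1 there and 0 at the other end
vanishes on the hull of `B`, so that end point can be dropped from `A` as well. -/
theorem hull_inter_of_subset_pair (hp : IsConvexPolygon p) {i k : Fin (n + 3)} (hik : i ≠ k)
    {A B : Finset (Fin (n + 3))} (hA : A ⊆ {i, k}) (hB : B ⊆ {i, k})
    {x : EuclideanSpace ℝ (Fin 2)} (hxA : x ∈ hull p A) (hxB : x ∈ hull p B) :
    x ∈ hull p (A ∩ B) := by
  have key : ∀ v w : Fin (n + 3), v ≠ w → B ⊆ {v, w} → v ∉ B → ∀ C ⊆ A, C ⊆ {v, w} →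
      x ∈ hull p C → x ∈ hull p (C.erase v) := by
    intro v w hvw hBvw hv C _ hC hxC
    obtain ⟨f, hf, hfv, hfw⟩ := IsAffineFun.exists_eq_on_pair (hp.injective.ne hvw) 1 0
    have hBz : ∀ j ∈ B, f (p j) = 0 := by
      intro j hj
      have := hBvw hj
      simp only [Finset.mem_insert, Finset.mem_singleton] at this
      rcases this with rfl | rfl
      · exact absurd hj hv
      · exact hfw
    have hx0 : f x = 0 := le_antisymm (hf.nonpos_of_mem_hull (fun j hj => (hBz j hj).le) hxB)
      (hf.nonneg_of_mem_hull (fun j hj => (hBz j hj).ge) hxB)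
    refine hf.mem_hull_of_eq_zero (fun j hj => ?_) hxC hx0 (fun j hj hj0 => ?_)
      (Finset.erase_subset _ _)
    · have := hC hj
      simp only [Finset.mem_insert, Finset.mem_singleton] at this
      rcases this with rfl | rfl
      · rw [hfv]; exact zero_le_one
      · rw [hfw]
    · refine Finset.mem_erase.2 ⟨?_, hj⟩
      rintro rfl
      rw [hfv] at hj0
      exact one_ne_zero hj0
  have hk := key k i hik.symm (by rwa [Finset.pair_comm])
  have hi := key i k hik hB
  by_cases hiB : i ∈ B
  · by_cases hkB : k ∈ B
    · convert hxA
      exact Finset.inter_eq_left.2 (hA.trans (by grind))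
    · exact hull_mono (by grind) (hk hkB A le_rfl (by rwa [Finset.pair_comm]) hxA)
  · have h1 := hi hiB A le_rfl hA hxA
    by_cases hkB : k ∈ B
    · exact hull_mono (by grind) h1
    · exact hull_mono (by grind) (hk hkB _ (Finset.erase_subset _ _) (by grind) h1)

/-- Two sets of vertices on different sides of a line through two vertices. -/
theorem hull_inter_of_separated (hp : IsConvexPolygon p) {i k : Fin (n + 3)} (hik : i < k)
    {σ τ : Finset (Fin (n + 3))} (hσ : σ ⊆ Finset.Icc i k) (hτ : ∀ u ∈ τ, ¬(i < u ∧ u < k)) :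
    hull p σ ∩ hull p τ = hull p (σ ∩ τ) := by
  apply subset_antisymm
  · rintro x ⟨hxσ, hxτ⟩
    have hf := IsAffineFun.orient_middle (p i) (p k)
    have h1 : ∀ j ∈ σ, 0 ≤ orient (p i) (p j) (p k) := fun j hj =>
      hp.orient_nonneg (Finset.mem_Icc.1 (hσ hj)).1 (Finset.mem_Icc.1 (hσ hj)).2
    have h2 : ∀ j ∈ τ, orient (p i) (p j) (p k) ≤ 0 := fun j hj => hp.orient_nonpos hik (hτ j hj)
    have h0 : orient (p i) x (p k) = 0 :=
      le_antisymm (hf.nonpos_of_mem_hull h2 hxτ) (hf.nonneg_of_mem_hull h1 hxσ)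
    have hz : ∀ j, orient (p i) (p j) (p k) = 0 → j ∈ ({i, k} : Finset (Fin (n + 3))) := by
      intro j hj
      by_contra hjn
      simp only [Finset.mem_insert, Finset.mem_singleton, not_or] at hjn
      exact hp.orient_ne_zero (Ne.symm hjn.1) hjn.2 hik.ne hj
    have hxσ' := hf.mem_hull_of_eq_zero h1 hxσ h0 (τ := σ ∩ {i, k})
      (fun j hj hj0 => Finset.mem_inter.2 ⟨hj, hz j hj0⟩) Finset.inter_subset_left
    have hxτ' := hf.mem_hull_of_eq_zero' h2 hxτ h0 (τ := τ ∩ {i, k})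
      (fun j hj hj0 => Finset.mem_inter.2 ⟨hj, hz j hj0⟩) Finset.inter_subset_left
    exact hull_mono (by grind) (hp.hull_inter_of_subset_pair hik.ne Finset.inter_subset_right
      Finset.inter_subset_right hxσ' hxτ')
  · exact Set.subset_inter (hull_mono Finset.inter_subset_left) (hull_mono Finset.inter_subset_right)

/-- A chord cuts the hull of a set of vertices into two pieces. -/
theorem hull_subset_union (hp : IsConvexPolygon p) {i k : Fin (n + 3)} (hik : i < k)
    {S : Finset (Fin (n + 3))} (hi : i ∈ S) (hk : k ∈ S) :
    hull p S ⊆ hull p (S.filter fun u => i ≤ u ∧ u ≤ k) ∪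
      hull p (S.filter fun u => ¬(i < u ∧ u < k)) := by
  intro x hx
  set A := S.filter fun u => i ≤ u ∧ u ≤ k with hA
  set B := S.filter fun u => ¬(i < u ∧ u < k) with hB
  have hAB : (p '' (S : Set (Fin (n + 3)))) = p '' (A : Set (Fin (n + 3))) ∪ p '' B := by
    rw [← Set.image_union, ← Finset.coe_union]
    congr 2
    ext u
    grind
  have hiA : i ∈ A := by grind
  have hiB : i ∈ B := by grind
  have hx' := hx
  have hAn : (p '' (A : Set (Fin (n + 3)))).Nonempty := ⟨_, i, hiA, rfl⟩
  have hBn : (p '' (B : Set (Fin (n + 3)))).Nonempty := ⟨_, i, hiB, rfl⟩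
  rw [hull, hAB, convexHull_union hAn hBn, mem_convexJoin] at hx'
  obtain ⟨y, hy, z, hz, hxyz⟩ := hx'
  have hf := IsAffineFun.orient_middle (p i) (p k)
  have hfy : 0 ≤ orient (p i) y (p k) := hf.nonneg_of_mem_hull (σ := A)
    (fun j hj => hp.orient_nonneg (by grind) (by grind)) hy
  have hfz : orient (p i) z (p k) ≤ 0 := hf.nonpos_of_mem_hull (σ := B)
    (fun j hj => hp.orient_nonpos hik (by grind)) hz
  have hcut : ∀ w ∈ segment ℝ y z, orient (p i) w (p k) = 0 → w ∈ hull p {i, k} := by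
    intro w hw h0
    exact hp.mem_hull_pair_of_orient_eq_zero hik
      ((convex_hull _).segment_subset (hull_mono (Finset.subset_univ A) hy)
        (hull_mono (Finset.subset_univ B) hz) hw) h0
  rcases le_total 0 (orient (p i) x (p k)) with h | h
  · exact Or.inl (hf.mem_of_mem_segment (convex_hull A) hy hfz hxyz h
      fun w hw h0 => hull_mono (by grind) (hcut w hw h0))
  · refine Or.inr (hf.neg.mem_of_mem_segment (convex_hull B) hz (neg_nonpos.2 hfy)
      (segment_symm ℝ y z ▸ hxyz) (neg_nonneg.2 h) fun w hw h0 => ?_)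
    exact hull_mono (by grind) (hcut w (segment_symm ℝ y z ▸ hw) (by simpa using h0))

/-- Two chords whose end points alternate meet. -/
theorem exists_mem_segment_orient_eq_zero (hp : IsConvexPolygon p) {i k u w : Fin (n + 3)}
    (hik : i < k) (hu : i < u ∧ u < k) (hw : w < i ∨ k < w) :
    ∃ a b : ℝ, 0 < a ∧ 0 < b ∧ a + b = 1 ∧ a • p u + b • p w ∈ hull p {i, k} ∧
      orient (p i) (a • p u + b • p w) (p k) = 0 := by
  have h1 := hp.orient_pos hu.1 hu.2
  have h2 := hp.orient_neg hik hw
  set f := orient (p i) (p u) (p k)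
  set g := orient (p i) (p w) (p k)
  have hd : 0 < f - g := by linarith
  have hab : -g / (f - g) + f / (f - g) = 1 := by field_simp; ring
  have h0 : orient (p i) ((-g / (f - g)) • p u + (f / (f - g)) • p w) (p k) = 0 := by
    rw [(IsAffineFun.orient_middle _ _).combo hab]
    change -g / (f - g) * f + f / (f - g) * g = 0
    field_simp
    ring
  have ha : 0 < -g / (f - g) := div_pos (by linarith) hd
  have hb : 0 < f / (f - g) := div_pos h1 hd
  exact ⟨_, _, ha, hb, hab, hp.mem_hull_pair_of_orient_eq_zero hik
    ((convex_hull _) (mem_hull_of_mem (Finset.mem_univ u)) (mem_hull_of_mem (Finset.mem_univ w))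
      ha.le hb.le hab) h0, h0⟩

theorem notMem_hull_pair (hp : IsConvexPolygon p) {i u w : Fin (n + 3)} (hiu : i ≠ u)
    (hiw : i ≠ w) (huw : u ≠ w) : p i ∉ hull p {u, w} := by
  intro h
  have hf := IsAffineFun.orient_middle (p u) (p w)
  have h0 : ∀ j ∈ ({u, w} : Finset (Fin (n + 3))), orient (p u) (p j) (p w) = 0 := by
    intro j hj
    simp only [Finset.mem_insert, Finset.mem_singleton] at hj
    rcases hj with rfl | rfl <;> simp
  exact hp.orient_ne_zero hiu.symm hiw huw (le_antisymm
    (hf.nonpos_of_mem_hull (fun j hj => (h0 j hj).le) h)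
    (hf.nonneg_of_mem_hull (fun j hj => (h0 j hj).ge) h))

theorem affineIndependent_triangle (hp : IsConvexPolygon p) {a b c : Fin (n + 3)} (hab : a ≠ b)
    (hac : a ≠ c) (hbc : b ≠ c) :
    AffineIndependent ℝ fun i : ({a, b, c} : Finset (Fin (n + 3))) => p i := by
  apply affineIndependent_of_forall_exists
  have key : ∀ a b c : Fin (n + 3), a ≠ b → a ≠ c → b ≠ c →
      ∃ f, IsAffineFun f ∧ f (p a) ≠ 0 ∧ f (p b) = 0 ∧ f (p c) = 0 :=
    fun a b c hab hac hbc => ⟨_, .orient_middle (p b) (p c),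
      hp.orient_ne_zero hab.symm hac hbc, by simp, by simp⟩
  rintro ⟨i, hi⟩
  simp only [Finset.mem_insert, Finset.mem_singleton] at hi
  rcases hi with rfl | rfl | rfl
  · obtain ⟨f, hf, h1, h2, h3⟩ := key i b c hab hac hbc
    exact ⟨f, hf, h1, by rintro ⟨j, hj⟩ hji; simp at hj hji; grind⟩
  · obtain ⟨f, hf, h1, h2, h3⟩ := key i a c hab.symm hbc hac
    exact ⟨f, hf, h1, by rintro ⟨j, hj⟩ hji; simp at hj hji; grind⟩
  · obtain ⟨f, hf, h1, h2, h3⟩ := key i a b hac.symm hbc.symm hab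
    exact ⟨f, hf, h1, by rintro ⟨j, hj⟩ hji; simp at hj hji; grind⟩

theorem volume_hull_triangle (hp : IsConvexPolygon p) {i j k : Fin (n + 3)} (hij : i < j)
    (hjk : j < k) :
    volume.real (hull p {i, j, k}) = volume.real stdTriangle * orient (p i) (p j) (p k) := by
  rw [← abs_of_pos (hp.orient_pos hij hjk), ← volume_convexHull_triangle]
  simp [hull, Set.image_insert_eq]

end IsConvexPolygon

/-! ### Recursive triangulations, their chords and flips -/

/-- `PolyTri i j T`: `T` is the set of triangles of a triangulation of the polygon with vertices
`i, i + 1, …, j`, built by choosing the third vertex `k` of the triangle on the side `{i, j}`. -/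
inductive PolyTri {m : ℕ} : Fin m → Fin m → Finset (Finset (Fin m)) → Prop
  | side {i j : Fin m} (h : i ⋖ j) : PolyTri i j ∅
  | node {i k j : Fin m} {T₁ T₂ : Finset (Finset (Fin m))} (hik : i < k) (hkj : k < j)
      (h₁ : PolyTri i k T₁) (h₂ : PolyTri k j T₂) : PolyTri i j (insert {i, k, j} (T₁ ∪ T₂))

/-- The vertices of `τ` lie on one side of the chord `{a, b}`. -/
def OnOneSide {m : ℕ} (a b : Fin m) (τ : Finset (Fin m)) : Prop :=
  (∀ u ∈ τ, a ≤ u ∧ u ≤ b) ∨ ∀ u ∈ τ, ¬(a < u ∧ u < b)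

section Rotation

variable {α : Type*} [DecidableEq α] {A B C : Finset α} {r r' s s' : α}

/-- The flip at an edge of the root triangle: `A`, `B`, `C` are the triangulations beyond three
sides of the quadrilateral, `s`, `s'` the old triangles and `r`, `r'` the new ones. -/
theorem insert_union_insert_union_eq (hs : s ∉ A ∪ B ∪ C) (hs' : s' ∉ A ∪ B ∪ C) :
    insert r (A ∪ insert r' (B ∪ C)) =
      (insert s' (insert s (A ∪ B) ∪ C)) \ {s, s'} ∪ {r, r'} := by
  ext x
  grind

/-- A flip inside the subtree `A` is a flip of the whole: the sibling subtree `B` and the root `q`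
contain neither of the removed triangles. -/
theorem insert_flip_union_eq (hs : s ∈ A) (hs' : s' ∈ A) (hsB : s ∉ B) (hsB' : s' ∉ B)
    {q : α} (hq : q ∉ A) :
    insert q ((A \ {s, s'} ∪ {r, r'}) ∪ B) = (insert q (A ∪ B)) \ {s, s'} ∪ {r, r'} := by
  ext x
  grind

end Rotation

namespace PolyTri

variable {m : ℕ} {i j k : Fin m} {T T₁ T₂ : Finset (Finset (Fin m))} {σ τ : Finset (Fin m)}

theorem lt (h : PolyTri i j T) : i < j := by
  cases h with
  | side h => exact h.1
  | node hik hkj _ _ => exact hik.trans hkj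

theorem bounds (h : PolyTri i j T) (hσ : σ ∈ T) : ∀ u ∈ σ, i ≤ u ∧ u ≤ j := by
  induction h with
  | side h => simp at hσ
  | node hik hkj h₁ h₂ ih₁ ih₂ =>
    simp only [Finset.mem_insert, Finset.mem_union] at hσ
    rcases hσ with rfl | hσ | hσ
    · intro u hu
      simp only [Finset.mem_insert, Finset.mem_singleton] at hu
      rcases hu with rfl | rfl | rfl
      · exact ⟨le_rfl, (hik.trans hkj).le⟩
      · exact ⟨hik.le, hkj.le⟩
      · exact ⟨(hik.trans hkj).le, le_rfl⟩
    · exact fun u hu => ⟨(ih₁ hσ u hu).1, (ih₁ hσ u hu).2.trans hkj.le⟩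
    · exact fun u hu => ⟨hik.le.trans (ih₂ hσ u hu).1, (ih₂ hσ u hu).2⟩

theorem exists_eq (h : PolyTri i j T) (hσ : σ ∈ T) : ∃ a b c, a < b ∧ b < c ∧ σ = {a, b, c} := by
  induction h with
  | side h => simp at hσ
  | node hik hkj h₁ h₂ ih₁ ih₂ =>
    simp only [Finset.mem_insert, Finset.mem_union] at hσ
    rcases hσ with rfl | hσ | hσ
    · exact ⟨_, _, _, hik, hkj, rfl⟩
    · exact ih₁ hσ
    · exact ih₂ hσ

theorem notMem_of_mem (h₁ : PolyTri i k T₁) (h₂ : PolyTri k j T₂) (hσ : σ ∈ T₁) : σ ∉ T₂ := by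
  intro hσ'
  obtain ⟨a, b, c, hab, hbc, rfl⟩ := h₁.exists_eq hσ
  have h1 := (h₁.bounds hσ b (by simp)).2
  have h2 := (h₂.bounds hσ' a (by simp)).1
  exact (hab.trans_le h1).not_ge h2

theorem notMem_of_lt (h : PolyTri i j T) {u : Fin m} (hu : u ∈ σ) (h' : u < i ∨ j < u) : σ ∉ T := by
  intro hσ
  have := h.bounds hσ u hu
  rcases h' with h' | h'
  · exact h'.not_ge this.1
  · exact h'.not_ge this.2

theorem sum_node {M : Type*} [AddCommMonoid M] (f : Finset (Fin m) → M) (h₁ : PolyTri i k T₁)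
    (h₂ : PolyTri k j T₂) :
    ∑ σ ∈ insert {i, k, j} (T₁ ∪ T₂), f σ = f {i, k, j} + (∑ σ ∈ T₁, f σ + ∑ σ ∈ T₂, f σ) := by
  rw [Finset.sum_insert, Finset.sum_union]
  · exact Finset.disjoint_left.2 fun σ hσ => h₁.notMem_of_mem h₂ hσ
  · rw [Finset.mem_union, not_or]
    exact ⟨h₁.notMem_of_lt (u := j) (by simp) (Or.inr h₂.lt),
      h₂.notMem_of_lt (u := i) (by simp) (Or.inl h₁.lt)⟩

/-- Distinct triangles are separated by a chord. -/
theorem exists_separating (h : PolyTri i j T) (hσ : σ ∈ T) (hτ : τ ∈ T) (hne : σ ≠ τ) :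
    ∃ a b, a < b ∧ (((∀ u ∈ σ, a ≤ u ∧ u ≤ b) ∧ ∀ u ∈ τ, ¬(a < u ∧ u < b)) ∨
      ((∀ u ∈ τ, a ≤ u ∧ u ≤ b) ∧ ∀ u ∈ σ, ¬(a < u ∧ u < b))) := by
  induction h with
  | side h => simp at hσ
  | @node i k j T₁ T₂ hik hkj h₁ h₂ ih₁ ih₂ =>
    have b₁ := fun {σ} (hσ : σ ∈ T₁) => h₁.bounds hσ
    have b₂ := fun {σ} (hσ : σ ∈ T₂) => h₂.bounds hσ
    simp only [Finset.mem_insert, Finset.mem_union] at hσ hτ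
    have root₁ : ∀ u ∈ ({i, k, j} : Finset (Fin m)), ¬(i < u ∧ u < k) := by
      intro u hu
      simp only [Finset.mem_insert, Finset.mem_singleton] at hu
      rcases hu with rfl | rfl | rfl
      · exact fun h => lt_irrefl _ h.1
      · exact fun h => lt_irrefl _ h.2
      · exact fun h => lt_asymm h.2 hkj
    have root₂ : ∀ u ∈ ({i, k, j} : Finset (Fin m)), ¬(k < u ∧ u < j) := by
      intro u hu
      simp only [Finset.mem_insert, Finset.mem_singleton] at hu
      rcases hu with rfl | rfl | rfl
      · exact fun h => lt_asymm h.1 hik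
      · exact fun h => lt_irrefl _ h.1
      · exact fun h => lt_irrefl _ h.2
    rcases hσ with rfl | hσ | hσ <;> rcases hτ with rfl | hτ | hτ
    · exact absurd rfl hne
    · exact ⟨i, k, hik, Or.inr ⟨b₁ hτ, root₁⟩⟩
    · exact ⟨k, j, hkj, Or.inr ⟨b₂ hτ, root₂⟩⟩
    · exact ⟨i, k, hik, Or.inl ⟨b₁ hσ, root₁⟩⟩
    · exact ih₁ hσ hτ
    · exact ⟨i, k, hik, Or.inl ⟨b₁ hσ, fun u hu h => h.2.not_ge (b₂ hτ u hu).1⟩⟩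
    · exact ⟨k, j, hkj, Or.inl ⟨b₂ hσ, root₂⟩⟩
    · exact ⟨i, k, hik, Or.inr ⟨b₁ hτ, fun u hu h => h.2.not_ge (b₂ hσ u hu).1⟩⟩
    · exact ih₂ hσ hτ

/-- Another triangle is separated by a chord from the one with the edge `{a, b}`. As `a` and `b` lie
on the same side of that chord, whatever is beyond it lies on one side of `{a, b}`. -/
theorem onOneSide_of_hasFace (h : PolyTri i j T) {a b : Fin m} (hab : a < b)
    (hf : HasFace T {a, b}) (hτ : τ ∈ T) : OnOneSide a b τ := by
  obtain ⟨σ, hσ, hs⟩ := hf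
  have ha : a ∈ σ := hs (by simp)
  have hb : b ∈ σ := hs (by simp)
  by_cases hne : σ = τ
  · subst hne
    obtain ⟨x, y, z, hxy, hyz, rfl⟩ := h.exists_eq hσ
    unfold OnOneSide
    simp only [Finset.mem_insert, Finset.mem_singleton] at ha hb ⊢
    grind
  · obtain ⟨c, d, hcd, ⟨h1, h2⟩ | ⟨h1, h2⟩⟩ := h.exists_separating hσ hτ hne
    · exact Or.inr fun u hu hu' =>
        h2 u hu ⟨(h1 a ha).1.trans_lt hu'.1, hu'.2.trans_le (h1 b hb).2⟩
    · have h2a := h2 a ha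
      have h2b := h2 b hb
      unfold OnOneSide
      by_cases hac : a ≤ c
      · by_cases hdb : d ≤ b
        · exact Or.inl fun u hu => ⟨hac.trans (h1 u hu).1, (h1 u hu).2.trans hdb⟩
        · refine Or.inr fun u hu => ?_
          have := h1 u hu
          grind
      · refine Or.inr fun u hu => ?_
        have := h1 u hu
        grind

theorem hasFace_root (h : PolyTri i j T) (hij : ¬ i ⋖ j) : HasFace T {i, j} := by
  cases h with
  | side h => exact absurd h hij
  | node hik hkj h₁ h₂ => exact ⟨_, Finset.mem_insert_self _ _, by grind⟩

/-- Descend into the subpolygon that contains both `a` and `b`. When the apex `k` separates them,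
the root triangle has vertices strictly on both sides of `{a, b}` unless this chord is the base. -/
theorem hasFace_of_forall_onOneSide (h : PolyTri i j T) {a b : Fin m} (hab : a < b)
    (hcov : ¬ a ⋖ b) (hia : i ≤ a) (hbj : b ≤ j) (hT : ∀ τ ∈ T, OnOneSide a b τ) :
    HasFace T {a, b} := by
  induction h with
  | @side i j h =>
    have h1 := h.2
    have : a = i ∧ b = j := by
      constructor
      · by_contra hne
        exact h1 (lt_of_le_of_ne hia (Ne.symm hne)) (hab.trans_le hbj)
      · by_contra hne
        exact h1 (hia.trans_lt hab) (lt_of_le_of_ne hbj hne)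
    exact absurd (this.1 ▸ this.2 ▸ h) hcov
  | @node i k j T₁ T₂ hik hkj h₁ h₂ ih₁ ih₂ =>
    rcases le_or_gt b k with hbk | hkb
    · obtain ⟨σ, hσ, hs⟩ := ih₁ hia hbk fun τ hτ => hT τ (by simp [hτ])
      exact ⟨σ, by simp [hσ], hs⟩
    · rcases le_or_gt k a with hka | hak
      · obtain ⟨σ, hσ, hs⟩ := ih₂ hka hbj fun τ hτ => hT τ (by simp [hτ])
        exact ⟨σ, by simp [hσ], hs⟩
      · refine ⟨{i, k, j}, by simp, ?_⟩
        have := hT {i, k, j} (by simp)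
        unfold OnOneSide at this
        simp only [Finset.mem_insert, Finset.mem_singleton, forall_eq_or_imp, forall_eq] at this
        have h1 : a = i := by grind
        have h2 : b = j := by grind
        subst h1 h2
        grind

/-- Vertices are added one at a time, each by gluing one triangle: a fan at `i` reaches `b` on the
right, then a fan at `b` reaches `a` on the left. -/
theorem exists_extend (h : PolyTri i j T) {a b : Fin m} (hai : a ≤ i) (hjb : j ≤ b) :
    ∃ T', T ⊆ T' ∧ PolyTri a b T' := by
  have right : ∀ b : Fin m, j ≤ b → ∃ T', T ⊆ T' ∧ PolyTri i b T' := by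
    intro b
    induction b using WellFoundedLT.induction with
    | ind b ih =>
      intro hjb
      rcases hjb.eq_or_lt with rfl | hlt
      · exact ⟨T, subset_rfl, h⟩
      · obtain ⟨c, hjc, hcb⟩ := exists_le_covBy_of_lt hlt
        obtain ⟨T', hT', h'⟩ := ih c hcb.1 hjc
        exact ⟨_, hT'.trans (by grind), node h'.lt hcb.1 h' (side hcb)⟩
  obtain ⟨T', hT', h'⟩ := right b hjb
  have left : ∀ a : Fin m, a ≤ i → ∃ T'', T' ⊆ T'' ∧ PolyTri a b T'' := by
    intro a
    induction a using WellFoundedGT.induction with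
    | ind a ih =>
      intro hai
      rcases hai.eq_or_lt with rfl | hlt
      · exact ⟨T', subset_rfl, h'⟩
      · obtain ⟨c, hac, hci⟩ := exists_covBy_le_of_lt hlt
        obtain ⟨T'', hT'', h''⟩ := ih c hac.1 hci
        exact ⟨_, hT''.trans (by grind), node hac.1 h''.lt (side hac) h''⟩
  obtain ⟨T'', hT'', h''⟩ := left a hai
  exact ⟨T'', hT'.trans hT'', h''⟩

theorem exists_of_lt (hij : i < j) : ∃ T, PolyTri i j T := by
  obtain ⟨c, hic, hcj⟩ := exists_covBy_le_of_lt hij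
  obtain ⟨T, -, h⟩ := (side hic).exists_extend le_rfl hcj
  exact ⟨T, h⟩

/-- The triangles on both sides of an interior chord can be flipped. -/
theorem exists_flip (h : PolyTri i j T) {a b : Fin m} (hab : a < b) (hcov : ¬ a ⋖ b)
    (hne : a ≠ i ∨ b ≠ j) (hf : HasFace T {a, b}) :
    ∃ v z T', PolyTri i j T' ∧ (a < v ∧ v < b) ∧ (z < a ∨ b < z) ∧ {a, v, b} ∈ T ∧ {a, b, z} ∈ T ∧
      T' = (T \ {{a, v, b}, {a, b, z}}) ∪ {{a, v, z}, {v, b, z}} := by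
  induction h with
  | side h =>
    obtain ⟨σ, hσ, -⟩ := hf
    simp at hσ
  | @node i k j T₁ T₂ hik hkj h₁ h₂ ih₁ ih₂ =>
    have key : (a = i ∧ b = k) ∨ (a = k ∧ b = j) ∨ ((a ≠ i ∨ b ≠ k) ∧ HasFace T₁ {a, b}) ∨
        ((a ≠ k ∨ b ≠ j) ∧ HasFace T₂ {a, b}) := by
      obtain ⟨σ, hσ, hs⟩ := hf
      simp only [Finset.mem_insert, Finset.mem_union] at hσ
      rcases hσ with rfl | hσ | hσ
      · have ha : a ∈ ({i, k, j} : Finset (Fin m)) := hs (by simp)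
        have hb : b ∈ ({i, k, j} : Finset (Fin m)) := hs (by simp)
        simp only [Finset.mem_insert, Finset.mem_singleton] at ha hb
        grind
      · by_cases h : a = i ∧ b = k
        · exact Or.inl h
        · exact Or.inr (Or.inr (Or.inl ⟨by tauto, σ, hσ, hs⟩))
      · by_cases h : a = k ∧ b = j
        · exact Or.inr (Or.inl h)
        · exact Or.inr (Or.inr (Or.inr ⟨by tauto, σ, hσ, hs⟩))
    rcases key with ⟨rfl, rfl⟩ | ⟨rfl, rfl⟩ | ⟨hne', hf'⟩ | ⟨hne', hf'⟩
    · cases h₁ with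
      | side h => exact absurd h hcov
      | @node _ v _ T₁₁ T₁₂ hav hvb h₁₁ h₁₂ =>
        refine ⟨v, j, _, node hav (hvb.trans hkj) h₁₁ (node hvb hkj h₁₂ h₂), ⟨hav, hvb⟩,
          Or.inr hkj, by simp, by simp, ?_⟩
        have e1 : {a, v, b} ∉ T₁₁ := h₁₁.notMem_of_lt (u := b) (by simp) (Or.inr hvb)
        have e2 : {a, v, b} ∉ T₁₂ := h₁₂.notMem_of_lt (u := a) (by simp) (Or.inl hav)
        have e3 : {a, v, b} ∉ T₂ := h₂.notMem_of_lt (u := a) (by simp) (Or.inl hab)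
        have e4 : {a, b, j} ∉ T₁₁ := h₁₁.notMem_of_lt (u := b) (by simp) (Or.inr hvb)
        have e5 : {a, b, j} ∉ T₁₂ := h₁₂.notMem_of_lt (u := a) (by simp) (Or.inl hav)
        have e6 : {a, b, j} ∉ T₂ := h₂.notMem_of_lt (u := a) (by simp) (Or.inl hab)
        exact insert_union_insert_union_eq (by simp [e1, e2, e3]) (by simp [e4, e5, e6])
    · cases h₂ with
      | side h => exact absurd h hcov
      | @node _ v _ T₂₁ T₂₂ hav hvb h₂₁ h₂₂ =>
        have r1 : ({a, b, i} : Finset (Fin m)) = {i, a, b} := by grind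
        have r2 : ({a, v, i} : Finset (Fin m)) = {i, a, v} := by grind
        have r3 : ({v, b, i} : Finset (Fin m)) = {i, v, b} := by grind
        refine ⟨v, i, _, node (hik.trans hav) hvb (node hik hav h₁ h₂₁) h₂₂, ⟨hav, hvb⟩,
          Or.inl hik, by simp, by simp [r1], ?_⟩
        rw [r1, r2, r3]
        have e1 : {a, v, b} ∉ T₂₁ := h₂₁.notMem_of_lt (u := b) (by simp) (Or.inr hvb)
        have e2 : {a, v, b} ∉ T₂₂ := h₂₂.notMem_of_lt (u := a) (by simp) (Or.inl hav)
        have e3 : {a, v, b} ∉ T₁ := h₁.notMem_of_lt (u := b) (by simp) (Or.inr hab)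
        have e4 : {i, a, b} ∉ T₂₁ := h₂₁.notMem_of_lt (u := b) (by simp) (Or.inr hvb)
        have e5 : {i, a, b} ∉ T₂₂ := h₂₂.notMem_of_lt (u := a) (by simp) (Or.inl hav)
        have e6 : {i, a, b} ∉ T₁ := h₁.notMem_of_lt (u := b) (by simp) (Or.inr hab)
        have := insert_union_insert_union_eq (A := T₂₂) (B := T₂₁) (C := T₁) (r := {i, v, b})
          (r' := {i, a, v}) (s := {a, v, b}) (s' := {i, a, b}) (by simp [e1, e2, e3])
          (by simp [e4, e5, e6])
        rw [Finset.union_comm _ T₂₂, Finset.union_comm T₁ T₂₁, this, Finset.union_comm T₂₂,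
          Finset.union_comm _ T₁, Finset.pair_comm ({i, v, b} : Finset (Fin m))]
    · obtain ⟨v, z, T', h', hv, hz, hm1, hm2, rfl⟩ := ih₁ hne' hf'
      refine ⟨v, z, _, node hik hkj h' h₂, hv, hz, by simp [hm1], by simp [hm2], ?_⟩
      have e1 := h₁.notMem_of_mem h₂ hm1
      have e2 := h₁.notMem_of_mem h₂ hm2
      have e3 : {i, k, j} ∉ T₁ := h₁.notMem_of_lt (u := j) (by simp) (Or.inr hkj)
      exact insert_flip_union_eq hm1 hm2 e1 e2 e3
    · obtain ⟨v, z, T', h', hv, hz, hm1, hm2, rfl⟩ := ih₂ hne' hf'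
      refine ⟨v, z, _, node hik hkj h₁ h', hv, hz, by simp [hm1], by simp [hm2], ?_⟩
      have e1 := fun h => h₁.notMem_of_mem h₂ h hm1
      have e2 := fun h => h₁.notMem_of_mem h₂ h hm2
      have e3 : {i, k, j} ∉ T₂ := h₂.notMem_of_lt (u := i) (by simp) (Or.inl hik)
      rw [Finset.union_comm T₁, Finset.union_comm T₁]
      exact insert_flip_union_eq hm1 hm2 e1 e2 e3

end PolyTri

/-! ### The positive part of an affine function on a triangle -/

/-- The divided difference of the square of the positive part. -/
def posSlope (u v : ℝ) : ℝ :=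
  if 0 ≤ u ∧ 0 ≤ v then u + v else if u ≤ 0 ∧ v ≤ 0 then 0 else (max u v) ^ 2 / |u - v|

theorem posSlope_comm (u v : ℝ) : posSlope u v = posSlope v u := by
  unfold posSlope
  simp only [and_comm, max_comm u v, abs_sub_comm u v, add_comm u v]

theorem posSlope_of_nonneg {u v : ℝ} (hu : 0 ≤ u) (hv : 0 ≤ v) : posSlope u v = u + v :=
  if_pos ⟨hu, hv⟩

theorem posSlope_of_nonpos {u v : ℝ} (hu : u ≤ 0) (hv : v ≤ 0) : posSlope u v = 0 := by
  unfold posSlope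
  split_ifs with h
  · linarith [h.1, h.2]
  · rfl
  · tauto

theorem posSlope_of_pos_of_nonpos {u v : ℝ} (hu : 0 < u) (hv : v ≤ 0) :
    posSlope u v = u ^ 2 / (u - v) := by
  unfold posSlope
  split_ifs with h h'
  · have : v = 0 := le_antisymm hv h.2
    subst this
    rw [sub_zero, pow_two, add_zero, mul_div_assoc, div_self hu.ne', mul_one]
  · linarith [h'.1]
  · rw [max_eq_left (hv.trans hu.le), abs_of_pos (by linarith)]

theorem posSlope_of_nonneg_of_neg {u v : ℝ} (hu : 0 ≤ u) (hv : v < 0) :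
    posSlope u v = u ^ 2 / (u - v) := by
  rcases hu.eq_or_lt with rfl | hu
  · rw [posSlope_of_nonpos le_rfl hv.le]
    simp
  · exact posSlope_of_pos_of_nonpos hu hv.le

/-- The integral of the positive part of an affine function over a triangle is at most the value
given by its linear interpolation, with equality if the function does not change sign. -/
theorem posSlope_triangle {A B C u v w : ℝ} (h0 : A * u + B * v + C * w = 0)
    (hD : 0 < A + B + C) :
    C * posSlope u v + A * posSlope v w + B * posSlope w u ≤
        (A + B + C) * (max 0 u + (max 0 v + max 0 w)) ∧
      ((A + B + C) * (max 0 u + (max 0 v + max 0 w)) =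
          C * posSlope u v + A * posSlope v w + B * posSlope w u ↔
        (0 ≤ u ∧ 0 ≤ v ∧ 0 ≤ w) ∨ (u ≤ 0 ∧ v ≤ 0 ∧ w ≤ 0)) := by
  have nonneg : ∀ {A B C u v w : ℝ}, A * u + B * v + C * w = 0 → 0 ≤ u → 0 ≤ v → 0 ≤ w →
      (A + B + C) * (max 0 u + (max 0 v + max 0 w)) =
        C * posSlope u v + A * posSlope v w + B * posSlope w u := by
    intro A B C u v w h0 hu hv hw
    rw [posSlope_of_nonneg hu hv, posSlope_of_nonneg hv hw, posSlope_of_nonneg hw hu,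
      max_eq_right hu, max_eq_right hv, max_eq_right hw]
    linear_combination h0
  have one_pos : ∀ {A B C u v w : ℝ}, A * u + B * v + C * w = 0 → 0 < A + B + C → 0 < u → v ≤ 0 →
      w ≤ 0 → (v < 0 ∨ w < 0) → C * posSlope u v + A * posSlope v w + B * posSlope w u <
        (A + B + C) * (max 0 u + (max 0 v + max 0 w)) := by
    intro A B C u v w h0 hD hu hv hw hvw
    rw [posSlope_of_pos_of_nonpos hu hv, posSlope_comm w u, posSlope_of_pos_of_nonpos hu hw,
      posSlope_of_nonpos hv hw, max_eq_right hu.le, max_eq_left hv, max_eq_left hw, ← sub_pos]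
    have h1 : 0 < u - v := by linarith
    have h2 : 0 < u - w := by linarith
    have h3 : 0 < (u - v) * (u - w) - u ^ 2 := by
      rcases hvw with h | h <;> nlinarith [mul_nonneg_of_nonpos_of_nonpos hv hw]
    have : (A + B + C) * (u + (0 + 0)) - (C * (u ^ 2 / (u - v)) + A * 0 + B * (u ^ 2 / (u - w))) =
        (A + B + C) * u * ((u - v) * (u - w) - u ^ 2) / ((u - v) * (u - w)) := by
      field_simp
      linear_combination (u ^ 2) * h0
    rw [this]
    positivity
  have one_neg : ∀ {A B C u v w : ℝ}, A * u + B * v + C * w = 0 → 0 < A + B + C → u < 0 → 0 ≤ v →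
      0 ≤ w → (0 < v ∨ 0 < w) → C * posSlope u v + A * posSlope v w + B * posSlope w u <
        (A + B + C) * (max 0 u + (max 0 v + max 0 w)) := by
    intro A B C u v w h0 hD hu hv hw hvw
    rw [posSlope_comm u v, posSlope_of_nonneg_of_neg hv hu, posSlope_of_nonneg_of_neg hw hu,
      posSlope_of_nonneg hv hw, max_eq_left hu.le, max_eq_right hv, max_eq_right hw, ← sub_pos]
    have h1 : 0 < v - u := by linarith
    have h2 : 0 < w - u := by linarith
    have h3 : 0 < (v - u) * (w - u) - u ^ 2 := by
      rcases hvw with h | h <;> nlinarith [mul_nonneg hv hw]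
    have hu' : 0 < -u := by linarith
    have : (A + B + C) * (0 + (v + w)) -
        (C * (v ^ 2 / (v - u)) + A * (v + w) + B * (w ^ 2 / (w - u))) =
        (A + B + C) * (-u) * ((v - u) * (w - u) - u ^ 2) / ((v - u) * (w - u)) := by
      field_simp
      linear_combination (-u * v - u * w + v * w) * h0
    rw [this]
    positivity
  have strict : ¬((0 ≤ u ∧ 0 ≤ v ∧ 0 ≤ w) ∨ (u ≤ 0 ∧ v ≤ 0 ∧ w ≤ 0)) →
      C * posSlope u v + A * posSlope v w + B * posSlope w u <
        (A + B + C) * (max 0 u + (max 0 v + max 0 w)) := by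
    intro hn
    -- Cyclic rotation brings every mixed sign pattern to one with a single positive or a single
    -- negative value in the first place.
    have rot₁ : B * v + C * w + A * u = 0 := by linarith
    have rot₂ : C * w + A * u + B * v = 0 := by linarith
    have hD₁ : 0 < B + C + A := by linarith
    have hD₂ : 0 < C + A + B := by linarith
    rcases lt_trichotomy u 0 with hu | hu | hu <;> rcases lt_trichotomy v 0 with hv | hv | hv <;>
      rcases lt_trichotomy w 0 with hw | hw | hw <;>
      first
      | exact absurd (Or.inl ⟨by linarith, by linarith, by linarith⟩) hn
      | exact absurd (Or.inr ⟨by linarith, by linarith, by linarith⟩) hn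
      | exact one_pos h0 hD hu (by linarith) (by linarith) (by tauto)
      | exact one_neg h0 hD hu (by linarith) (by linarith) (by tauto)
      | linarith [one_pos rot₁ hD₁ hv (by linarith) (by linarith) (by tauto)]
      | linarith [one_neg rot₁ hD₁ hv (by linarith) (by linarith) (by tauto)]
      | linarith [one_pos rot₂ hD₂ hw (by linarith) (by linarith) (by tauto)]
      | linarith [one_neg rot₂ hD₂ hw (by linarith) (by linarith) (by tauto)]
  by_cases hs : (0 ≤ u ∧ 0 ≤ v ∧ 0 ≤ w) ∨ (u ≤ 0 ∧ v ≤ 0 ∧ w ≤ 0)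
  · have heq : (A + B + C) * (max 0 u + (max 0 v + max 0 w)) =
        C * posSlope u v + A * posSlope v w + B * posSlope w u := by
      rcases hs with ⟨hu, hv, hw⟩ | ⟨hu, hv, hw⟩
      · exact nonneg h0 hu hv hw
      · rw [posSlope_of_nonpos hu hv, posSlope_of_nonpos hv hw, posSlope_of_nonpos hw hu,
          max_eq_left hu, max_eq_left hv, max_eq_left hw]
        ring
    exact ⟨heq.ge, iff_of_true heq hs⟩
  · exact ⟨(strict hs).le, iff_of_false (strict hs).ne' hs⟩

/-! ### Vertex functionals and telescoping over edges -/

/-- Three times the integral of the piecewise linear function with values `ω i` at the vertices. -/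
def cellSum {m : ℕ} (p : Fin m → EuclideanSpace ℝ (Fin 2)) (ω : Fin m → ℝ)
    (T : Finset (Finset (Fin m))) : ℝ :=
  ∑ σ ∈ T, volume.real (hull p σ) * ∑ i ∈ σ, ω i

theorem sum_mul_gkz {m : ℕ} (p : Fin m → EuclideanSpace ℝ (Fin 2)) (ω : Fin m → ℝ)
    (T : Finset (Finset (Fin m))) : ∑ i, ω i * gkz p T i = cellSum p ω T := by
  simp only [gkz, cellSum, Finset.sum_filter, Finset.mul_sum]
  rw [Finset.sum_comm]
  refine Finset.sum_congr rfl fun σ _ => ?_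
  simp only [mul_ite, mul_zero, Finset.sum_ite_mem, Finset.univ_inter]
  exact Finset.sum_congr rfl fun i _ => mul_comm _ _

theorem cellSum_add {m : ℕ} (p : Fin m → EuclideanSpace ℝ (Fin 2)) (ω ω' : Fin m → ℝ)
    (T : Finset (Finset (Fin m))) :
    cellSum p (fun i => ω i + ω' i) T = cellSum p ω T + cellSum p ω' T := by
  simp only [cellSum, Finset.sum_add_distrib, mul_add]

theorem cellSum_sum {m : ℕ} (p : Fin m → EuclideanSpace ℝ (Fin 2)) {ι : Type*} (s : Finset ι)
    (c : ι → ℝ) (ω : ι → Fin m → ℝ) (T : Finset (Finset (Fin m))) :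
    cellSum p (fun i => ∑ q ∈ s, c q * ω q i) T = ∑ q ∈ s, c q * cellSum p (ω q) T := by
  simp only [cellSum, Finset.mul_sum]
  symm
  rw [Finset.sum_comm]
  refine Finset.sum_congr rfl fun σ _ => ?_
  rw [Finset.sum_comm]
  exact Finset.sum_congr rfl fun i _ => Finset.sum_congr rfl fun q _ => by ring

/-- The restriction to the vertices of the convex piecewise linear function that vanishes on one
side of the chord `{a, b}`. -/
def fold {m : ℕ} (p : Fin m → EuclideanSpace ℝ (Fin 2)) (a b x : Fin m) : ℝ :=
  max 0 (orient (p a) (p x) (p b))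

theorem exists_potential {m : ℕ} (H : Fin m → Fin m → ℝ) :
    ∃ B : Fin m → ℝ, ∀ i j, i ⋖ j → B j - B i = H i j := by
  classical
  -- `B k` sums `H` over the sides before `k`. The chosen `y` is the successor of `x`; the default
  -- is harmless, since every `x < k` has a successor.
  refine ⟨fun k => ∑ x with x < k, H x (if h : ∃ y, x ⋖ y then h.choose else x), ?_⟩
  intro i j hij
  have h1 : (Finset.univ.filter fun x => x < j) = insert i (Finset.univ.filter fun x => x < i) := by
    ext x
    simp only [Finset.mem_filter, Finset.mem_univ, true_and, Finset.mem_insert]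
    rw [hij.lt_iff_le_left, le_iff_eq_or_lt]
  have h2 : ∃ y, i ⋖ y := ⟨j, hij⟩
  have h3 : h2.choose = j := h2.choose_spec.unique_right hij
  dsimp only
  rw [h1, Finset.sum_insert (by simp), dif_pos h2, h3]
  ring

namespace PolyTri

variable {m : ℕ} {p : Fin m → EuclideanSpace ℝ (Fin 2)} {i j : Fin m}
  {T : Finset (Finset (Fin m))}

/-- A discrete Stokes formula: if each triangle contributes at least the sum of `H` over its
boundary, the terms of inner edges cancel, and there remain the sides, collected in the potential
`B`, and the base. Equality holds if and only if it holds in every triangle, which is what `P`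
records. -/
theorem cellSum_bound (h : PolyTri i j T) {ω : Fin m → ℝ} {H : Fin m → Fin m → ℝ} {B : Fin m → ℝ}
    {P : Finset (Fin m) → Prop} (hB : ∀ i j, i ⋖ j → B j - B i = H i j)
    (hH : ∀ i k j, i < k → k < j →
      H i k + H k j - H i j ≤ volume.real (hull p {i, k, j}) * (ω i + (ω k + ω j)) ∧
      (volume.real (hull p {i, k, j}) * (ω i + (ω k + ω j)) = H i k + H k j - H i j ↔
        P {i, k, j})) :
    B j - B i - H i j ≤ cellSum p ω T ∧
      (cellSum p ω T = B j - B i - H i j ↔ ∀ τ ∈ T, P τ) := by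
  induction h with
  | side h => simp [cellSum, hB _ _ h]
  | @node i k j T₁ T₂ hik hkj h₁ h₂ ih₁ ih₂ =>
    have hs : cellSum p ω (insert {i, k, j} (T₁ ∪ T₂)) =
        volume.real (hull p {i, k, j}) * (ω i + (ω k + ω j)) +
          (cellSum p ω T₁ + cellSum p ω T₂) := by
      unfold cellSum
      rw [h₁.sum_node _ h₂, Finset.sum_insert, Finset.sum_pair hkj.ne]
      simp [hik.ne, (hik.trans hkj).ne]
    have h0 := hH i k j hik hkj
    simp only [Finset.forall_mem_insert, Finset.forall_mem_union]
    rw [← h0.2, ← ih₁.2, ← ih₂.2, hs]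
    refine ⟨by linarith [h0.1, ih₁.1, ih₂.1], fun h => ⟨?_, ?_, ?_⟩, fun ⟨e0, e1, e2⟩ => ?_⟩ <;>
      linarith [h0.1, ih₁.1, ih₂.1]

end PolyTri

/-! ### Folds: minimality and spanning -/

namespace IsConvexPolygon

variable {n : ℕ} {p : Fin (n + 3) → EuclideanSpace ℝ (Fin 2)}

theorem orient_nonneg_iff (hp : IsConvexPolygon p) {a b u : Fin (n + 3)} (hab : a < b) :
    0 ≤ orient (p a) (p u) (p b) ↔ a ≤ u ∧ u ≤ b := by
  refine ⟨fun h => ?_, fun h => hp.orient_nonneg h.1 h.2⟩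
  by_contra hcon
  exact (hp.orient_neg hab (by grind)).not_ge h

theorem orient_nonpos_iff (hp : IsConvexPolygon p) {a b u : Fin (n + 3)} (hab : a < b) :
    orient (p a) (p u) (p b) ≤ 0 ↔ ¬(a < u ∧ u < b) :=
  ⟨fun h h' => (hp.orient_pos h'.1 h'.2).not_ge h, hp.orient_nonpos hab⟩

/-- The interpolation of an affine function is the function itself, whatever the triangulation. The
edge term is the signed integral, times three, over the triangle spanned by the edge and the origin,
so the bound is an equality. -/
theorem exists_cellSum_affine (hp : IsConvexPolygon p) {f : EuclideanSpace ℝ (Fin 2) → ℝ}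
    (hf : IsAffineFun f) (i j : Fin (n + 3)) :
    ∃ c, ∀ T, PolyTri i j T → cellSum p (fun x => f (p x)) T = c := by
  set H : Fin (n + 3) → Fin (n + 3) → ℝ := fun x y =>
    volume.real stdTriangle * (orient 0 (p x) (p y) * (f 0 + f (p x) + f (p y))) with hH
  obtain ⟨B, hB⟩ := exists_potential H
  refine ⟨B j - B i - H i j, fun T hT => ?_⟩
  refine ((hT.cellSum_bound (P := fun _ => True) hB fun i k j hik hkj => ?_).2).2 fun _ _ => trivial
  rw [hp.volume_hull_triangle hik hkj]
  have : volume.real stdTriangle * orient (p i) (p k) (p j) * (f (p i) + (f (p k) + f (p j))) =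
      H i k + H k j - H i j := by
    obtain ⟨α, β, γ, hf⟩ := hf
    simp only [hH, hf, orient, PiLp.zero_apply]
    ring
  exact ⟨this.ge, iff_of_true this trivial⟩

/-- The edge term is three times the signed integral of the positive part over the triangle with
vertices `p a`, `p x`, `p y`. As its apex lies on the crease, the values at `x` and `y` determine it
through `posSlope`. The constant `c` depends on the boundary only. -/
theorem exists_cellSum_fold (hp : IsConvexPolygon p) {a b i j : Fin (n + 3)} (hab : a < b)
    (hcov : ¬ a ⋖ b) (hia : i ≤ a) (hbj : b ≤ j) :
    ∃ c, ∀ T, PolyTri i j T → c ≤ cellSum p (fold p a b) T ∧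
      (cellSum p (fold p a b) T = c ↔ HasFace T {a, b}) := by
  set H : Fin (n + 3) → Fin (n + 3) → ℝ := fun x y => volume.real stdTriangle *
    (orient (p a) (p x) (p y) *
      posSlope (orient (p a) (p x) (p b)) (orient (p a) (p y) (p b))) with hH
  obtain ⟨B, hB⟩ := exists_potential H
  refine ⟨B j - B i - H i j, fun T hT => ?_⟩
  have hκ := volume_stdTriangle_pos
  have key := hT.cellSum_bound (p := p) (ω := fold p a b) (P := OnOneSide a b) hB
    fun i k j hik hkj => by
      rw [hp.volume_hull_triangle hik hkj]
      -- Up to a common factor the coefficients are the barycentric coordinates of `p a` in the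
      -- triangle, and the affine function `orient (p a) · (p b)` vanishes at `p a`.
      have h0 : orient (p a) (p k) (p j) * orient (p a) (p i) (p b) +
          orient (p a) (p j) (p i) * orient (p a) (p k) (p b) +
          orient (p a) (p i) (p k) * orient (p a) (p j) (p b) = 0 := by
        unfold orient; ring
      have hD : orient (p a) (p k) (p j) + orient (p a) (p j) (p i) + orient (p a) (p i) (p k) =
          orient (p i) (p k) (p j) := by
        unfold orient; ring
      have := posSlope_triangle h0 (by rw [hD]; exact hp.orient_pos hik hkj)
      rw [hD] at this
      have hsum : H i k + H k j - H i j = volume.real stdTriangle *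
          (orient (p a) (p i) (p k) *
              posSlope (orient (p a) (p i) (p b)) (orient (p a) (p k) (p b)) +
            orient (p a) (p k) (p j) *
              posSlope (orient (p a) (p k) (p b)) (orient (p a) (p j) (p b)) +
            orient (p a) (p j) (p i) *
              posSlope (orient (p a) (p j) (p b)) (orient (p a) (p i) (p b))) := by
        simp only [hH]
        rw [orient_swap (p a) (p i) (p j), posSlope_comm (orient (p a) (p j) (p b))]
        ring
      rw [hsum, mul_assoc]
      refine ⟨mul_le_mul_of_nonneg_left this.1 hκ.le, ?_⟩
      rw [mul_right_inj' hκ.ne']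
      refine this.2.trans ?_
      unfold OnOneSide
      simp only [Finset.mem_insert, Finset.mem_singleton, forall_eq_or_imp, forall_eq,
        hp.orient_nonneg_iff hab, hp.orient_nonpos_iff hab]
  refine ⟨key.1, key.2.trans ⟨fun h => hT.hasFace_of_forall_onOneSide hab hcov hia hbj h,
    fun h τ hτ => hT.onOneSide_of_hasFace hab h hτ⟩⟩

theorem fold_eq_zero (hp : IsConvexPolygon p) {a b x : Fin (n + 3)} (hab : a < b)
    (h : ¬(a < x ∧ x < b)) : fold p a b x = 0 :=
  max_eq_left (hp.orient_nonpos hab h)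

theorem fold_eq_orient (hp : IsConvexPolygon p) {a b x : Fin (n + 3)}
    (h : a ≤ x ∧ x ≤ b) : fold p a b x = orient (p a) (p x) (p b) :=
  max_eq_right (hp.orient_nonneg h.1 h.2)

/-- The folds along the chords of a triangulation span the functions on the vertices that vanish
at the ends of the base. -/
theorem exists_eq_sum_fold_of_zero (hp : IsConvexPolygon p) {i j : Fin (n + 3)}
    {T : Finset (Finset (Fin (n + 3)))} (h : PolyTri i j T) (ω : Fin (n + 3) → ℝ) (hi : ω i = 0)
    (hj : ω j = 0) : ∃ c : Fin (n + 3) × Fin (n + 3) → ℝ,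
      (∀ q, c q ≠ 0 → q.1 < q.2 ∧ ¬ q.1 ⋖ q.2 ∧ i ≤ q.1 ∧ q.2 ≤ j ∧ HasFace T {q.1, q.2}) ∧
      ∀ x, i ≤ x → x ≤ j → ω x = ∑ q, c q * fold p q.1 q.2 x := by
  induction h generalizing ω with
  | @side i j h =>
    refine ⟨fun _ => 0, by simp, fun x hix hxj => ?_⟩
    rcases hix.eq_or_lt with rfl | hix
    · simp [hi]
    · rcases hxj.eq_or_lt with rfl | hxj
      · simp [hj]
      · exact absurd hxj (h.2 hix)
  | @node i k j T₁ T₂ hik hkj h₁ h₂ ih₁ ih₂ =>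
    have hpos := hp.orient_pos hik hkj
    have hij := hik.trans hkj
    -- With this coefficient the remainder vanishes at `k`; since the fold of the base vanishes at
    -- `i` and `j`, both induction hypotheses apply to the remainder.
    set c₀ := ω k / orient (p i) (p k) (p j) with hc₀
    have z0 : fold p i j i = 0 := hp.fold_eq_zero hij (by grind)
    have z1 : fold p i j j = 0 := hp.fold_eq_zero hij (by grind)
    have zk : ω k - c₀ * fold p i j k = 0 := by
      rw [hp.fold_eq_orient ⟨hik.le, hkj.le⟩, hc₀, div_mul_cancel₀ _ hpos.ne', sub_self]
    obtain ⟨c₁, hc₁, e₁⟩ := ih₁ (fun x => ω x - c₀ * fold p i j x) (by simp [z0, hi]) zk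
    obtain ⟨c₂, hc₂, e₂⟩ := ih₂ (fun x => ω x - c₀ * fold p i j x) zk (by simp [z1, hj])
    refine ⟨fun q => (Pi.single (i, j) c₀ : Fin (n + 3) × Fin (n + 3) → ℝ) q + c₁ q + c₂ q, fun q hq => ?_, fun x hix hxj => ?_⟩
    · dsimp only at hq
      by_cases hq1 : c₁ q = 0
      · by_cases hq2 : c₂ q = 0
        · rw [hq1, hq2, add_zero, add_zero] at hq
          have : q = (i, j) := by
            by_contra hne
            exact hq (Pi.single_eq_of_ne hne _)
          subst this
          exact ⟨hij, fun hc => hc.2 hik hkj, le_rfl, le_rfl,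
            (PolyTri.node hik hkj h₁ h₂).hasFace_root fun hc => hc.2 hik hkj⟩
        · obtain ⟨g1, g2, g3, g4, σ, hσ, hs⟩ := hc₂ q hq2
          exact ⟨g1, g2, hik.le.trans g3, g4, σ, by simp [hσ], hs⟩
      · obtain ⟨g1, g2, g3, g4, σ, hσ, hs⟩ := hc₁ q hq1
        exact ⟨g1, g2, g3, g4.trans hkj.le, σ, by simp [hσ], hs⟩
    · have hsum : ∑ q, ((Pi.single (i, j) c₀ : Fin (n + 3) × Fin (n + 3) → ℝ) q + c₁ q + c₂ q) * fold p q.1 q.2 x =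
          c₀ * fold p i j x + ∑ q, c₁ q * fold p q.1 q.2 x + ∑ q, c₂ q * fold p q.1 q.2 x := by
        simp only [add_mul, Finset.sum_add_distrib]
        congr 2
        rw [Finset.sum_eq_single (i, j)]
        · simp
        · intro q _ hq
          rw [Pi.single_eq_of_ne hq, zero_mul]
        · simp
      rw [hsum]
      rcases le_total x k with hxk | hkx
      · have h2 : ∑ q, c₂ q * fold p q.1 q.2 x = 0 := Finset.sum_eq_zero fun q _ => by
          by_cases hq : c₂ q = 0
          · rw [hq, zero_mul]
          · obtain ⟨g1, g2, g3, g4, -⟩ := hc₂ q hq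
            rw [hp.fold_eq_zero g1 (by grind), mul_zero]
        rw [h2, ← e₁ x hix hxk]
        ring
      · have h1 : ∑ q, c₁ q * fold p q.1 q.2 x = 0 := Finset.sum_eq_zero fun q _ => by
          by_cases hq : c₁ q = 0
          · rw [hq, zero_mul]
          · obtain ⟨g1, g2, g3, g4, -⟩ := hc₁ q hq
            rw [hp.fold_eq_zero g1 (by grind), mul_zero]
        rw [h1, ← e₂ x hkx hxj]
        ring

/-- Every function on the vertices is, up to an affine function, a combination of the folds along
the diagonals of a given triangulation. -/
theorem exists_eq_affine_add_sum_fold (hp : IsConvexPolygon p)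
    {T : Finset (Finset (Fin (n + 3)))} (h : PolyTri 0 (Fin.last (n + 2)) T)
    (ω : Fin (n + 3) → ℝ) : ∃ f, IsAffineFun f ∧ ∃ c : Fin (n + 3) × Fin (n + 3) → ℝ,
      (∀ q, c q ≠ 0 → q.1 < q.2 ∧ ¬ q.1 ⋖ q.2 ∧ (q.1 ≠ 0 ∨ q.2 ≠ Fin.last (n + 2)) ∧
        HasFace T {q.1, q.2}) ∧
      ∀ x, ω x = f (p x) + ∑ q, c q * fold p q.1 q.2 x := by
  obtain ⟨f, hf, hf0, hf1⟩ := IsAffineFun.exists_eq_on_pair (hp.injective.ne h.lt.ne) (ω 0)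
    (ω (Fin.last (n + 2)))
  obtain ⟨c, hc, e⟩ := hp.exists_eq_sum_fold_of_zero h (fun x => ω x - f (p x)) (by simp [hf0])
    (by simp [hf1])
  -- The base `{0, last}` is a side of the polygon, not a diagonal. Its fold is affine on the
  -- polygon and is absorbed into `f`.
  set r : Fin (n + 3) × Fin (n + 3) := (0, Fin.last (n + 2)) with hr
  refine ⟨fun x => f x + c r * orient (p 0) x (p (Fin.last (n + 2))),
    hf.add ((IsAffineFun.orient_middle _ _).const_mul _), Function.update c r 0,
    fun q hq => ?_, fun x => ?_⟩
  · have hqr : q ≠ r := by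
      rintro rfl
      simp at hq
    rw [Function.update_of_ne hqr] at hq
    obtain ⟨g1, g2, g3, g4, g5⟩ := hc q hq
    refine ⟨g1, g2, ?_, g5⟩
    by_contra! hcon
    exact hqr (Prod.ext hcon.1 hcon.2)
  · have := e x (Fin.zero_le x) (Fin.le_last x)
    rw [← Finset.add_sum_erase _ _ (Finset.mem_univ r)] at this
    rw [← Finset.add_sum_erase _ _ (Finset.mem_univ r), Function.update_self, zero_mul, zero_add]
    have h2 : ∑ q ∈ Finset.univ.erase r, Function.update c r 0 q * fold p q.1 q.2 x =
        ∑ q ∈ Finset.univ.erase r, c q * fold p q.1 q.2 x :=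
      Finset.sum_congr rfl fun q hq => by
        rw [Function.update_of_ne (Finset.ne_of_mem_erase hq)]
    rw [h2]
    have h3 : fold p r.1 r.2 x = orient (p 0) (p x) (p (Fin.last (n + 2))) :=
      hp.fold_eq_orient ⟨Fin.zero_le x, Fin.le_last x⟩
    rw [h3] at this
    dsimp only at this ⊢
    linarith

end IsConvexPolygon

theorem eq_of_combo_eq_max {α β x y z : ℝ} (hα : 0 < α) (hβ : 0 ≤ β)
    (hαβ : α + β = 1) (hz : z = α * x + β * y) (hx : x ≤ z) (hy : y ≤ z) : x = z := by
  by_contra hne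
  have h1 : α * x < α * z := mul_lt_mul_of_pos_left (lt_of_le_of_ne hx hne) hα
  have h2 : β * y ≤ β * z := mul_le_mul_of_nonneg_left hy hβ
  have h3 : α * z + β * z = z := by rw [← add_mul, hαβ, one_mul]
  linarith

/-! ### Geometric triangulations are the recursive ones -/

namespace IsConvexPolygon

variable {n : ℕ} {p : Fin (n + 3) → EuclideanSpace ℝ (Fin 2)}

/-- Cut the polygon along `{i, k}` and then along `{k, j}`. The hull of the base is added because a
single side carries no triangle. -/
theorem hull_Icc_subset (hp : IsConvexPolygon p) {i j : Fin (n + 3)}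
    {T : Finset (Finset (Fin (n + 3)))} (h : PolyTri i j T) :
    hull p (Finset.Icc i j) ⊆ hull p {i, j} ∪ ⋃ σ ∈ T, hull p σ := by
  induction h with
  | @side i j h =>
    refine (hull_mono fun u hu => ?_).trans Set.subset_union_left
    rw [Finset.mem_Icc] at hu
    have := h.2 (c := u)
    grind
  | @node i k j T₁ T₂ hik hkj h₁ h₂ ih₁ ih₂ =>
    intro x hx
    have root : x ∈ hull p {i, k, j} →
        x ∈ hull p {i, j} ∪ ⋃ σ ∈ insert {i, k, j} (T₁ ∪ T₂), hull p σ := fun h =>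
      Or.inr (Set.mem_biUnion (Finset.mem_insert_self _ _) h)
    rcases hp.hull_subset_union hik (by grind) (by grind) hx with h | h
    · rcases ih₁ (hull_mono (by grind) h) with h | h
      · exact root (hull_mono (by grind) h)
      · obtain ⟨σ, hσ, hxσ⟩ := Set.mem_iUnion₂.1 h
        exact Or.inr (Set.mem_biUnion (by simp [hσ]) hxσ)
    · rcases hp.hull_subset_union hkj (by grind) (by grind) h with h | h
      · rcases ih₂ (hull_mono (by grind) h) with h | h
        · exact root (hull_mono (by grind) h)
        · obtain ⟨σ, hσ, hxσ⟩ := Set.mem_iUnion₂.1 h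
          exact Or.inr (Set.mem_biUnion (by simp [hσ]) hxσ)
      · exact root (hull_mono (by grind) h)

theorem isTriangulation_of_polyTri (hp : IsConvexPolygon p) {T : Finset (Finset (Fin (n + 3)))}
    (h : PolyTri 0 (Fin.last (n + 2)) T) : IsTriangulation p T where
  card_eq σ hσ := by
    obtain ⟨a, b, c, hab, hbc, rfl⟩ := h.exists_eq hσ
    exact Finset.card_eq_three.2 ⟨a, b, c, hab.ne, (hab.trans hbc).ne, hbc.ne, rfl⟩
  affineIndependent σ hσ := by
    obtain ⟨a, b, c, hab, hbc, rfl⟩ := h.exists_eq hσ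
    exact hp.affineIndependent_triangle hab.ne (hab.trans hbc).ne hbc.ne
  cover := by
    rw [← hull_univ]
    apply subset_antisymm
    · exact Set.iUnion₂_subset fun σ _ => hull_mono (Finset.subset_univ σ)
    · have hcov : ¬ (0 : Fin (n + 3)) ⋖ Fin.last (n + 2) := fun hc =>
        hc.2 (c := 1) (by simp) (by simp [Fin.lt_def])
      obtain ⟨σ, hσ, hs⟩ := h.hasFace_root hcov
      intro x hx
      rcases hp.hull_Icc_subset h (hull_mono (fun u _ => by simp [Fin.le_last]) hx) with hx | hx
      · exact Set.mem_biUnion hσ (hull_mono hs hx)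
      · exact hx
  inter_eq σ hσ τ hτ := by
    by_cases hne : σ = τ
    · subst hne
      simp
    · obtain ⟨a, b, hab, ⟨h1, h2⟩ | ⟨h1, h2⟩⟩ := h.exists_separating hσ hτ hne
      · exact hp.hull_inter_of_separated hab (fun u hu => Finset.mem_Icc.2 (h1 u hu)) h2
      · rw [Set.inter_comm, Finset.inter_comm]
        exact hp.hull_inter_of_separated hab (fun u hu => Finset.mem_Icc.2 (h1 u hu)) h2

/-- If `τ` had vertices `u`, `w` strictly on both sides of the edge `{a, b}` of `σ`, the point where
the two segments meet would lie in the common face of `σ` and `τ`, and there on the edge. Unless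
both ends are in `τ`, that point is a vertex on the segment between two other vertices. Otherwise
`τ` has four vertices. -/
theorem onOneSide_of_isTriangulation (hp : IsConvexPolygon p)
    {t : Finset (Finset (Fin (n + 3)))} (ht : IsTriangulation p t) {a b : Fin (n + 3)}
    (hab : a < b) {σ τ : Finset (Fin (n + 3))} (hσ : σ ∈ t) (ha : a ∈ σ) (hb : b ∈ σ)
    (hτ : τ ∈ t) : OnOneSide a b τ := by
  by_contra hcon
  unfold OnOneSide at hcon
  push Not at hcon
  obtain ⟨⟨w, hw, hw'⟩, u, hu, hu'⟩ := hcon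
  have hw'' : w < a ∨ b < w := by grind
  obtain ⟨α, β, hα, hβ, hαβ, hx, h0⟩ := hp.exists_mem_segment_orient_eq_zero hab hu' hw''
  have hxp : α • p u + β • p w ∈ hull p {u, w} :=
    (convex_hull _) (mem_hull_of_mem (by simp)) (mem_hull_of_mem (by simp)) hα.le hβ.le hαβ
  set x := α • p u + β • p w
  have hxi : x ∈ hull p (σ ∩ τ) := by
    rw [← ht.inter_eq σ hσ τ hτ]
    exact ⟨hull_mono (by grind) hx, hull_mono (by grind) hxp⟩
  obtain ⟨c, hc⟩ : ∃ c, ∀ y ∈ σ, y = a ∨ y = b ∨ y = c := by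
    have h1 : ((σ.erase a).erase b).card = 1 := by
      rw [Finset.card_erase_of_mem (Finset.mem_erase.2 ⟨hab.ne', hb⟩),
        Finset.card_erase_of_mem ha, ht.card_eq σ hσ]
    obtain ⟨c, hc⟩ := Finset.card_eq_one.1 h1
    refine ⟨c, fun y hy => ?_⟩
    by_contra! hy'
    have : y ∈ (σ.erase a).erase b := by simp [hy, hy'.1, hy'.2.1]
    rw [hc, Finset.mem_singleton] at this
    exact hy'.2.2 this
  have hf := IsAffineFun.orient_middle (p a) (p b)
  have hz : ∀ y ∈ σ ∩ τ, orient (p a) (p y) (p b) = 0 →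
      y ∈ (σ ∩ τ).filter fun y => y = a ∨ y = b := by
    intro y hy hy0
    rw [Finset.mem_filter]
    refine ⟨hy, ?_⟩
    by_contra! hne
    exact hp.orient_ne_zero hne.1.symm hne.2 hab.ne hy0
  -- Besides `a` and `b` only `c` can occur in `σ`, so `σ` lies on one side of the line, and a point
  -- of the common face on that line is spanned by the ends present in it.
  have hxe : x ∈ hull p ((σ ∩ τ).filter fun y => y = a ∨ y = b) := by
    rcases le_total 0 (orient (p a) (p c) (p b)) with h | h
    · refine hf.mem_hull_of_eq_zero (fun y hy => ?_) hxi h0 hz (Finset.filter_subset _ _)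
      rcases hc y (Finset.mem_inter.1 hy).1 with rfl | rfl | rfl
      · simp
      · simp
      · exact h
    · refine hf.mem_hull_of_eq_zero' (fun y hy => ?_) hxi h0 hz (Finset.filter_subset _ _)
      rcases hc y (Finset.mem_inter.1 hy).1 with rfl | rfl | rfl
      · simp
      · simp
      · exact h
  have huw : u ≠ w := by grind
  have haτ : a ∈ τ := by
    by_contra haτ
    have : x ∈ hull p {b} := hull_mono (by grind) hxe
    rw [hull_singleton, Set.mem_singleton_iff] at this
    exact hp.notMem_hull_pair (by grind) (by grind) huw (this ▸ hxp)
  have hbτ : b ∈ τ := by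
    by_contra hbτ
    have : x ∈ hull p {a} := hull_mono (by grind) hxe
    rw [hull_singleton, Set.mem_singleton_iff] at this
    exact hp.notMem_hull_pair (by grind) (by grind) huw (this ▸ hxp)
  have hsub : ({a, b, u, w} : Finset (Fin (n + 3))) ⊆ τ := by
    intro y hy
    simp only [Finset.mem_insert, Finset.mem_singleton] at hy
    rcases hy with rfl | rfl | rfl | rfl <;> assumption
  have hcard : ({a, b, u, w} : Finset (Fin (n + 3))).card = 4 := by
    rw [Finset.card_insert_of_notMem, Finset.card_insert_of_notMem, Finset.card_pair huw] <;> grind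
  have := Finset.card_le_card hsub
  rw [hcard, ht.card_eq τ hτ] at this
  omega

/-- A chord that no triangle crosses is a side of a triangle on each side on which there are
vertices. -/
theorem exists_triangle_of_onOneSide (hp : IsConvexPolygon p)
    {t : Finset (Finset (Fin (n + 3)))} (ht : IsTriangulation p t) {i j : Fin (n + 3)}
    (hij : i < j) (hcov : ¬ i ⋖ j) (hs : ∀ τ ∈ t, OnOneSide i j τ) :
    ∃ k, i < k ∧ k < j ∧ {i, k, j} ∈ t := by
  obtain ⟨u, hiu, huj⟩ : ∃ u, i < u ∧ u < j := by
    by_contra! hcon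
    exact hcov ⟨hij, fun c hc hc' => (hcon c hc).not_gt hc'⟩
  have hf := IsAffineFun.orient_middle (p i) (p j)
  -- The midpoint of the chord is approached from the side of `u`. The points on the way lie in
  -- triangles on that side, whose union is closed, so one of these triangles contains the midpoint
  -- and must have both ends of the chord as vertices.
  set mid : EuclideanSpace ℝ (Fin 2) := (1 / 2 : ℝ) • p i + (1 / 2 : ℝ) • p j with hmid
  have hfm : orient (p i) mid (p j) = 0 := by
    rw [hmid, hf.combo (by norm_num)]
    simp
  set K : Set (EuclideanSpace ℝ (Fin 2)) :=
    ⋃ σ ∈ t.filter (fun σ => σ ⊆ Finset.Icc i j), hull p σ with hK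
  have hKc : IsClosed K := Set.Finite.isClosed_biUnion (Finset.finite_toSet _)
    fun σ _ => isClosed_hull σ
  have hmem : ∀ ε : ℝ, 0 < ε → ε < 1 → (1 - ε) • mid + ε • p u ∈ K := by
    intro ε h0 h1
    have hx : (1 - ε) • mid + ε • p u ∈ convexHull ℝ (Set.range p) := by
      rw [← hull_univ]
      have hc := convex_hull (p := p) Finset.univ
      have hv := fun v => mem_hull_of_mem (p := p) (Finset.mem_univ v)
      exact hc (hc (hv i) (hv j) (by norm_num) (by norm_num) (by norm_num)) (hv u)
        (by linarith) h0.le (by ring)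
    rw [← ht.cover] at hx
    obtain ⟨σ, hσ, hxσ⟩ := Set.mem_iUnion₂.1 hx
    have hpos : 0 < orient (p i) ((1 - ε) • mid + ε • p u) (p j) := by
      rw [hf.combo (by ring), hfm, mul_zero, zero_add]
      exact mul_pos h0 (hp.orient_pos hiu huj)
    rcases hs σ hσ with h | h
    · exact Set.mem_biUnion (Finset.mem_coe.2 (Finset.mem_filter.2
        ⟨hσ, fun v hv => Finset.mem_Icc.2 (h v hv)⟩)) hxσ
    · exact absurd (hf.nonpos_of_mem_hull (fun v hv => hp.orient_nonpos hij (h v hv)) hxσ)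
        hpos.not_ge
  have hmK : mid ∈ K := by
    have hcont : Continuous fun ε : ℝ => (1 - ε) • mid + ε • p u := by fun_prop
    have htend : Filter.Tendsto (fun ε : ℝ => (1 - ε) • mid + ε • p u)
        (nhdsWithin 0 (Set.Ioi 0)) (nhds mid) := by
      have := hcont.tendsto 0
      simp only [sub_zero, one_smul, zero_smul, add_zero] at this
      exact this.mono_left nhdsWithin_le_nhds
    refine hKc.mem_of_tendsto htend ?_
    filter_upwards [Ioo_mem_nhdsGT (zero_lt_one (α := ℝ))] with ε hε
    exact hmem ε hε.1 hε.2
  obtain ⟨σ, hσ, hmσ⟩ := Set.mem_iUnion₂.1 hmK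
  obtain ⟨hσt, hσI⟩ := Finset.mem_filter.1 hσ
  have hm : mid ∈ hull p (σ.filter fun v => v = i ∨ v = j) := by
    refine hf.mem_hull_of_eq_zero (fun v hv => ?_) hmσ hfm (fun v hv hv0 => ?_)
      (Finset.filter_subset _ _)
    · have := Finset.mem_Icc.1 (hσI hv)
      exact hp.orient_nonneg this.1 this.2
    · rw [Finset.mem_filter]
      refine ⟨hv, ?_⟩
      by_contra! hne
      exact hp.orient_ne_zero hne.1.symm hne.2 hij.ne hv0
  have hpij : p i ≠ p j := hp.injective.ne hij.ne
  have hiσ : i ∈ σ := by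
    by_contra hi
    have : mid ∈ hull p {j} := hull_mono (by grind) hm
    rw [hull_singleton, Set.mem_singleton_iff, hmid] at this
    apply hpij
    have h2 : (1 / 2 : ℝ) • p i = (1 / 2 : ℝ) • p j := by
      rw [← sub_eq_iff_eq_add.2 this.symm]
      module
    exact smul_right_injective _ (by norm_num : (1 / 2 : ℝ) ≠ 0) h2
  have hjσ : j ∈ σ := by
    by_contra hj
    have : mid ∈ hull p {i} := hull_mono (by grind) hm
    rw [hull_singleton, Set.mem_singleton_iff, hmid] at this
    apply hpij
    have h2 : (1 / 2 : ℝ) • p j = (1 / 2 : ℝ) • p i := by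
      rw [← sub_eq_iff_eq_add'.2 this.symm]
      module
    exact (smul_right_injective _ (by norm_num : (1 / 2 : ℝ) ≠ 0) h2).symm
  have h1 : ((σ.erase i).erase j).card = 1 := by
    rw [Finset.card_erase_of_mem (Finset.mem_erase.2 ⟨hij.ne', hjσ⟩),
      Finset.card_erase_of_mem hiσ, ht.card_eq σ hσt]
  obtain ⟨k, hk⟩ := Finset.card_eq_one.1 h1
  have hkσ : k ∈ (σ.erase i).erase j := by rw [hk]; simp
  simp only [Finset.mem_erase] at hkσ
  have hkI := Finset.mem_Icc.1 (hσI hkσ.2.2)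
  refine ⟨k, lt_of_le_of_ne hkI.1 (Ne.symm hkσ.2.1), lt_of_le_of_ne hkI.2 hkσ.1, ?_⟩
  convert hσt
  rw [← Finset.insert_erase hiσ, ← Finset.insert_erase (Finset.mem_erase.2 ⟨hij.ne', hjσ⟩), hk,
    Finset.pair_comm k j]

/-- Induction on the length of the chord. The triangle standing on an uncrossed chord has two
further edges, which are uncrossed again. A triangle within `[i, j]` on the outer side of both has
its vertices in `{i, k, j}`, so it is that triangle. -/
theorem polyTri_filter_of_isTriangulation (hp : IsConvexPolygon p)
    {t : Finset (Finset (Fin (n + 3)))} (ht : IsTriangulation p t) :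
    ∀ (N : ℕ) (i j : Fin (n + 3)), (j : ℕ) - i = N → i < j → (∀ τ ∈ t, OnOneSide i j τ) →
      PolyTri i j (t.filter fun σ => σ ⊆ Finset.Icc i j) := by
  intro N
  induction N using Nat.strong_induction_on with
  | _ N ih =>
    intro i j hN hij hs
    by_cases hcov : i ⋖ j
    · convert PolyTri.side hcov
      rw [Finset.filter_eq_empty_iff]
      intro σ hσ hσI
      have : σ ⊆ {i, j} := hσI.trans fun u hu => by
        rw [Finset.mem_Icc] at hu
        have := hcov.2 (c := u)
        grind
      have := (Finset.card_le_card this).trans Finset.card_le_two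
      rw [ht.card_eq σ hσ] at this
      omega
    · obtain ⟨k, hik, hkj, hk⟩ := hp.exists_triangle_of_onOneSide ht hij hcov hs
      have s₁ : ∀ τ ∈ t, OnOneSide i k τ := fun τ hτ =>
        hp.onOneSide_of_isTriangulation ht hik hk (by simp) (by simp) hτ
      have s₂ : ∀ τ ∈ t, OnOneSide k j τ := fun τ hτ =>
        hp.onOneSide_of_isTriangulation ht hkj hk (by simp) (by simp) hτ
      have l1 : (i : ℕ) < k := hik
      have l2 : (k : ℕ) < j := hkj
      have h₁ := ih ((k : ℕ) - i) (by omega) i k rfl hik s₁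
      have h₂ := ih ((j : ℕ) - k) (by omega) k j rfl hkj s₂
      convert PolyTri.node hik hkj h₁ h₂
      ext τ
      simp only [Finset.mem_filter, Finset.mem_insert, Finset.mem_union]
      constructor
      · rintro ⟨hτ, hτI⟩
        have hτI' : ∀ u ∈ τ, i ≤ u ∧ u ≤ j := fun u hu => Finset.mem_Icc.1 (hτI hu)
        rcases s₁ τ hτ with h1 | h1
        · exact Or.inr (Or.inl ⟨hτ, fun u hu => Finset.mem_Icc.2 (h1 u hu)⟩)
        · rcases s₂ τ hτ with h2 | h2
          · exact Or.inr (Or.inr ⟨hτ, fun u hu => Finset.mem_Icc.2 (h2 u hu)⟩)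
          · left
            refine Finset.eq_of_subset_of_card_le (fun u hu => ?_) ?_
            · have := hτI' u hu
              have := h1 u hu
              have := h2 u hu
              grind
            · rw [ht.card_eq _ hτ, ht.card_eq _ hk]
      · rintro (rfl | ⟨hτ, hI⟩ | ⟨hτ, hI⟩)
        · exact ⟨hk, by grind⟩
        · exact ⟨hτ, hI.trans (Finset.Icc_subset_Icc_right hkj.le)⟩
        · exact ⟨hτ, hI.trans (Finset.Icc_subset_Icc_left hik.le)⟩

theorem isTriangulation_iff (hp : IsConvexPolygon p) {t : Finset (Finset (Fin (n + 3)))} :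
    IsTriangulation p t ↔ PolyTri 0 (Fin.last (n + 2)) t := by
  refine ⟨fun ht => ?_, hp.isTriangulation_of_polyTri⟩
  have := hp.polyTri_filter_of_isTriangulation ht _ 0 (Fin.last (n + 2)) rfl
    (by simp [Fin.lt_def]) fun τ _ => Or.inl fun u _ => ⟨Fin.zero_le u, Fin.le_last u⟩
  rwa [Finset.filter_true_of_mem fun σ _ u _ => Finset.mem_Icc.2 ⟨Fin.zero_le u, Fin.le_last u⟩]
    at this

/-! ### Crossing and interior points -/

/-- The vertex is on a side, whose line supports the polygon; a step from it away from a vertex off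
this line leaves the polygon. -/
theorem notMem_interior (hp : IsConvexPolygon p) (v : Fin (n + 3)) :
    p v ∉ interior (convexHull ℝ (Set.range p)) := by
  intro hv
  have : ∃ a b : Fin (n + 3), a ⋖ b ∧ (v = a ∨ v = b) := by
    by_cases hm : v = 0
    · obtain ⟨b, hb, -⟩ := exists_covBy_le_of_lt (show (0 : Fin (n + 3)) < 1 by simp)
      exact ⟨0, b, hb, Or.inl hm⟩
    · obtain ⟨a, -, ha⟩ := exists_le_covBy_of_lt (Fin.pos_of_ne_zero hm)
      exact ⟨a, v, ha, Or.inr rfl⟩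
  obtain ⟨a, b, hab, hvab⟩ := this
  have hf := IsAffineFun.orient_middle (p a) (p b)
  have hfv : orient (p a) (p v) (p b) = 0 := by
    rcases hvab with rfl | rfl <;> simp
  have hneg : ∀ y ∈ convexHull ℝ (Set.range p), orient (p a) y (p b) ≤ 0 := by
    rw [← hull_univ]
    exact fun y hy => hf.nonpos_of_mem_hull
      (fun j _ => hp.orient_nonpos hab.1 fun h => hab.2 h.1 h.2) hy
  obtain ⟨w, hw⟩ : ∃ w, orient (p a) (p w) (p b) < 0 := by
    have : ∃ w : Fin (n + 3), w ∉ ({a, b} : Finset (Fin (n + 3))) := by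
      by_contra! hcon
      have h1 : Finset.univ ⊆ ({a, b} : Finset (Fin (n + 3))) := fun k _ => hcon k
      have h2 := (Finset.card_le_card h1).trans Finset.card_le_two
      simp at h2
    obtain ⟨w, hw⟩ := this
    simp only [Finset.mem_insert, Finset.mem_singleton, not_or] at hw
    exact ⟨w, lt_of_le_of_ne (hp.orient_nonpos hab.1 fun h => hab.2 h.1 h.2)
      (hp.orient_ne_zero (Ne.symm hw.1) hw.2 hab.1.ne)⟩
  have hcont : Continuous fun ε : ℝ => (1 + ε) • p v + (-ε) • p w := by fun_prop
  have htend : Filter.Tendsto (fun ε : ℝ => (1 + ε) • p v + (-ε) • p w)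
      (nhdsWithin 0 (Set.Ioi 0)) (nhds (p v)) := by
    have := hcont.tendsto 0
    simp only [add_zero, one_smul, neg_zero, zero_smul] at this
    exact this.mono_left nhdsWithin_le_nhds
  obtain ⟨ε, hε, hε0⟩ := ((htend.eventually (mem_interior_iff_mem_nhds.1 hv)).and
    self_mem_nhdsWithin).exists
  have := hneg _ hε
  rw [hf.combo (by ring), hfv] at this
  have hε0' : 0 < ε := hε0
  nlinarith

/-- The line through `a` and `b` separates the segments, so they meet at most in a common vertex,
which is no interior point. -/
theorem not_crosses_of_onOneSide (hp : IsConvexPolygon p) {a b : Fin (n + 3)} (hab : a < b)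
    {δ : Finset (Fin (n + 3))} (hδ : δ.card = 2) (hne : {a, b} ≠ δ) (h : OnOneSide a b δ) :
    ¬ Crosses p {a, b} δ := by
  rintro ⟨x, hx, hxi⟩
  have hinter : hull p {a, b} ∩ hull p δ = hull p ({a, b} ∩ δ) := by
    rcases h with h | h
    · rw [Set.inter_comm, Finset.inter_comm]
      exact hp.hull_inter_of_separated hab (fun u hu => Finset.mem_Icc.2 (h u hu)) (by grind)
    · exact hp.hull_inter_of_separated hab (by grind) h
  rw [hinter] at hx
  have hcard : ({a, b} ∩ δ).card ≤ 1 := by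
    by_contra hcon
    have hab2 : ({a, b} : Finset (Fin (n + 3))).card = 2 := Finset.card_pair hab.ne
    have e1 := Finset.eq_of_subset_of_card_le (Finset.inter_subset_left (s₁ := {a, b}) (s₂ := δ))
      (by omega)
    have e2 := Finset.eq_of_subset_of_card_le (Finset.inter_subset_right (s₁ := {a, b}) (s₂ := δ))
      (by omega)
    exact hne (e1.symm.trans e2)
  rcases Nat.le_one_iff_eq_zero_or_eq_one.1 hcard with h0 | h1
  · rw [Finset.card_eq_zero.1 h0, hull_empty] at hx
    exact hx
  · obtain ⟨v, hv⟩ := Finset.card_eq_one.1 h1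
    rw [hv, hull_singleton, Set.mem_singleton_iff] at hx
    exact hp.notMem_interior v (hx ▸ hxi)

theorem interior_nonempty (hp : IsConvexPolygon p) :
    (interior (convexHull ℝ (Set.range p))).Nonempty := by
  rw [interior_convexHull_nonempty_iff_affineSpan_eq_top]
  have h01 : (0 : Fin (n + 3)) < 1 := by simp
  have h12 : (1 : Fin (n + 3)) < Fin.last (n + 2) := by simp [Fin.lt_def]
  have hi := hp.affineIndependent_triangle h01.ne (h01.trans h12).ne h12.ne
  have hcard : Fintype.card ({0, 1, Fin.last (n + 2)} : Finset (Fin (n + 3))) = 3 := by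
    rw [Fintype.card_coe]
    exact Finset.card_eq_three.2 ⟨_, _, _, h01.ne, (h01.trans h12).ne, h12.ne, rfl⟩
  have htop := hi.affineSpan_eq_top_iff_card_eq_finrank_add_one.2 (by
    rw [hcard, finrank_euclideanSpace_fin])
  rw [eq_top_iff, ← htop]
  exact affineSpan_mono ℝ (by rintro _ ⟨v, rfl⟩; exact ⟨v, rfl⟩)

/-- A functional supporting the polygon at the meeting point, if that were not interior, would be
maximal at `u`, at `w` and at one of `a`, `b`. These are not collinear, so it would be constant, but
it is strictly smaller in the interior. -/
theorem crosses_of_alternating (hp : IsConvexPolygon p) {a b u w : Fin (n + 3)} (hab : a < b)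
    (hu : a < u ∧ u < b) (hw : w < a ∨ b < w) : Crosses p {a, b} {u, w} := by
  obtain ⟨α, β, hα, hβ, hαβ, hx, h0⟩ := hp.exists_mem_segment_orient_eq_zero hab hu hw
  refine ⟨α • p u + β • p w, ⟨hx, (convex_hull _) (mem_hull_of_mem (by simp))
    (mem_hull_of_mem (by simp)) hα.le hβ.le hαβ⟩, ?_⟩
  set x := α • p u + β • p w with hxdef
  by_contra hxi
  set C := convexHull ℝ (Set.range p) with hC
  have hCc : Convex ℝ C := convex_convexHull ℝ _
  obtain ⟨f, hf⟩ := geometric_hahn_banach_open_point hCc.interior isOpen_interior hxi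
  have hle : ∀ y ∈ C, f y ≤ f x := by
    intro y hy
    have hy' : y ∈ closure (interior C) := by
      rw [hCc.closure_interior_eq_closure_of_nonempty_interior hp.interior_nonempty]
      exact subset_closure hy
    exact closure_minimal (fun z hz => (hf z hz).le)
      (isClosed_le f.continuous continuous_const) hy'
  have hv : ∀ v, f (p v) ≤ f x := fun v => hle _ (subset_convexHull ℝ _ ⟨v, rfl⟩)
  have hfx : f x = α * f (p u) + β * f (p w) := by simp [hxdef]
  have hfu : f (p u) = f x := eq_of_combo_eq_max hα hβ.le hαβ hfx (hv u) (hv w)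
  have hfw : f (p w) = f x := eq_of_combo_eq_max hβ hα.le (by linarith) (by linarith) (hv w) (hv u)
  have hz : ∃ z, z ≠ u ∧ z ≠ w ∧ f (p z) = f x := by
    rw [hull_pair] at hx
    obtain ⟨γ, δ, hγ, hδ, hγδ, hxe⟩ := hx
    have hfx' : f x = γ * f (p a) + δ * f (p b) := by rw [← hxe]; simp
    rcases hγ.eq_or_lt with rfl | hγ
    · refine ⟨b, by grind, by grind, ?_⟩
      have : δ = 1 := by linarith
      rw [hfx', this]
      ring
    · exact ⟨a, by grind, by grind, eq_of_combo_eq_max hγ hδ hγδ hfx' (hv a) (hv b)⟩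
  obtain ⟨z, hzu, hzw, hfz⟩ := hz
  have haff : IsAffineFun fun y => f y - f x := by
    refine ⟨⟨-f x, f !₂[1, 0], f !₂[0, 1], fun y => ?_⟩⟩
    have : y = y 0 • !₂[1, 0] + y 1 • !₂[0, 1] := by
      ext i
      fin_cases i <;> simp
    conv_lhs => rw [this]
    rw [map_add, map_smul, map_smul, smul_eq_mul, smul_eq_mul]
    ring
  have huw : u ≠ w := by grind
  obtain ⟨y, hy⟩ := hp.interior_nonempty
  have := haff.eq_zero_of_three (hp.orient_ne_zero hzu huw hzw) (by simp [hfz]) (by simp [hfu])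
    (by simp [hfw]) y
  linarith [hf y hy]

end IsConvexPolygon

/-! ### Diagonals in linear order and their common triangulations -/

/-- The vertices `a < b` are the ends of a diagonal of the polygon. -/
structure IsChord {n : ℕ} (a b : Fin (n + 3)) : Prop where
  lt : a < b
  not_covBy : ¬ a ⋖ b
  ne : a ≠ 0 ∨ b ≠ Fin.last (n + 2)

/-- In linear order a side is a covering pair, except for the side from the last vertex back to `0`;
that is why `IsChord` has a third condition. -/
theorem isDiagonal_iff {n : ℕ} {δ : Finset (Fin (n + 3))} :
    IsDiagonal δ ↔ ∃ a b, IsChord a b ∧ δ = {a, b} := by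
  constructor
  · rintro ⟨hcard, hside⟩
    have key : ∀ a b : Fin (n + 3), a < b → δ = {a, b} → IsChord a b := by
      intro a b hab hδ
      refine ⟨hab, fun hcov => hside a ?_, ?_⟩
      · have h1 := hcov.2 (c := a + 1)
        have h2 : ((a + 1 : Fin (n + 3)) : ℕ) = a + 1 :=
          Fin.val_add_one_of_lt (hab.trans_le (Fin.le_last b))
        simp only [Fin.lt_def, h2] at h1 hab
        rw [hδ]
        congr 2
        ext
        omega
      · by_contra! hcon
        apply hside (Fin.last (n + 2))
        rw [hδ, hcon.1, hcon.2, Fin.last_add_one, Finset.pair_comm]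
    obtain ⟨x, y, hxy, rfl⟩ := Finset.card_eq_two.1 hcard
    rcases lt_or_gt_of_ne hxy with h | h
    · exact ⟨x, y, key x y h rfl, rfl⟩
    · exact ⟨y, x, key y x h (Finset.pair_comm _ _), Finset.pair_comm _ _⟩
  · rintro ⟨a, b, h, rfl⟩
    refine ⟨Finset.card_pair h.lt.ne, fun i hi => ?_⟩
    have hab := h.lt
    have hne := h.ne
    have hcov := h.not_covBy
    have hcases : (a = i ∧ b = i + 1) ∨ (a = i + 1 ∧ b = i) := by
      have ha : a ∈ ({i, i + 1} : Finset (Fin (n + 3))) := hi ▸ by simp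
      have hb : b ∈ ({i, i + 1} : Finset (Fin (n + 3))) := hi ▸ by simp
      simp only [Finset.mem_insert, Finset.mem_singleton] at ha hb
      have := hab.ne
      grind
    rcases eq_or_ne i (Fin.last (n + 2)) with rfl | hil
    · rw [Fin.last_add_one] at hcases
      rcases hcases with ⟨rfl, rfl⟩ | ⟨rfl, rfl⟩
      · exact absurd hab (by simp)
      · simp at hne
    · have h2 : ((i + 1 : Fin (n + 3)) : ℕ) = i + 1 :=
        Fin.val_add_one_of_lt (lt_of_le_of_ne (Fin.le_last i) hil)
      rcases hcases with ⟨rfl, rfl⟩ | ⟨rfl, rfl⟩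
      · refine hcov ⟨hab, fun c h1 h3 => ?_⟩
        simp only [Fin.lt_def] at h1 h3
        omega
      · simp only [Fin.lt_def] at hab
        omega

theorem HasFace.mono {m : ℕ} {T T' : Finset (Finset (Fin m))} {δ : Finset (Fin m)}
    (h : HasFace T δ) (hT : T ⊆ T') : HasFace T' δ :=
  let ⟨σ, hσ, hs⟩ := h
  ⟨σ, hT hσ, hs⟩

/-- In linear order, chords that do not alternate are nested or lie one after the other. Triangulate
below an inner chord, extend to the outer one or glue at a triangle, then extend to the whole
polygon. -/
theorem exists_polyTri_hasFace {n : ℕ} {a b a' b' : Fin (n + 3)} (h : IsChord a b)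
    (h' : IsChord a' b') (hs : OnOneSide a b {a', b'}) :
    ∃ T, PolyTri 0 (Fin.last (n + 2)) T ∧ HasFace T {a, b} ∧ HasFace T {a', b'} := by
  have ext_top : ∀ {i j T}, PolyTri i j T → HasFace T {a, b} → HasFace T {a', b'} →
      ∃ T, PolyTri 0 (Fin.last (n + 2)) T ∧ HasFace T {a, b} ∧ HasFace T {a', b'} := by
    intro i j T hT h1 h2
    obtain ⟨T', hTT', hT'⟩ := hT.exists_extend (Fin.zero_le i) (Fin.le_last j)
    exact ⟨T', hT', h1.mono hTT', h2.mono hTT'⟩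
  obtain ⟨S, hS⟩ := PolyTri.exists_of_lt h.lt
  obtain ⟨S', hS'⟩ := PolyTri.exists_of_lt h'.lt
  have fS := hS.hasFace_root h.not_covBy
  have fS' := hS'.hasFace_root h'.not_covBy
  have hlt := h.lt
  have hlt' := h'.lt
  have cases : (a ≤ a' ∧ b' ≤ b) ∨ (a' ≤ a ∧ b ≤ b') ∨ b' ≤ a ∨ b ≤ a' := by
    unfold OnOneSide at hs
    simp only [Finset.mem_insert, Finset.mem_singleton, forall_eq_or_imp, forall_eq] at hs
    grind
  rcases cases with ⟨h1, h2⟩ | ⟨h1, h2⟩ | h1 | h1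
  · obtain ⟨T, hST, hT⟩ := hS'.exists_extend h1 h2
    exact ext_top hT (hT.hasFace_root h.not_covBy) (fS'.mono hST)
  · obtain ⟨T, hST, hT⟩ := hS.exists_extend h1 h2
    exact ext_top hT (fS.mono hST) (hT.hasFace_root h'.not_covBy)
  · obtain ⟨T, hST, hT⟩ := hS'.exists_extend le_rfl h1
    exact ext_top (PolyTri.node hT.lt hlt hT hS) (fS.mono (by grind))
      ((fS'.mono hST).mono (by grind))
  · obtain ⟨T, hST, hT⟩ := hS'.exists_extend h1 le_rfl
    exact ext_top (PolyTri.node hlt hT.lt hS hT) (fS.mono (by grind))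
      ((fS'.mono hST).mono (by grind))

/-! ### Flips and fold coefficients -/

namespace IsConvexPolygon

variable {n : ℕ} {p : Fin (n + 3) → EuclideanSpace ℝ (Fin 2)} {a b : Fin (n + 3)}
  {t t' : Finset (Finset (Fin (n + 3)))}

theorem exists_hasFace (hp : IsConvexPolygon p) (h : IsChord a b) :
    ∃ t, IsTriangulation p t ∧ HasFace t {a, b} := by
  obtain ⟨T, hT, h1, -⟩ := exists_polyTri_hasFace h h
    (Or.inl fun u hu => by have := h.lt; grind)
  exact ⟨T, hp.isTriangulation_iff.2 hT, h1⟩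

/-- The fold along a diagonal is minimized exactly by the triangulations that contain it. -/
theorem cellSum_fold_le (hp : IsConvexPolygon p) (h : IsChord a b) (ht : IsTriangulation p t)
    (hf : HasFace t {a, b}) (ht' : IsTriangulation p t') :
    cellSum p (fold p a b) t ≤ cellSum p (fold p a b) t' ∧
      (cellSum p (fold p a b) t' = cellSum p (fold p a b) t ↔ HasFace t' {a, b}) := by
  obtain ⟨c, hc⟩ := hp.exists_cellSum_fold h.lt h.not_covBy (Fin.zero_le a) (Fin.le_last b)
  have h1 := hc t (hp.isTriangulation_iff.1 ht)
  have h2 := hc t' (hp.isTriangulation_iff.1 ht')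
  rw [h1.2.2 hf]
  exact h2

/-- The flip at a diagonal of a triangulation. -/
theorem exists_isFlip (hp : IsConvexPolygon p) (h : IsChord a b) (ht : IsTriangulation p t)
    (hf : HasFace t {a, b}) :
    ∃ t₁, IsFlip p t t₁ ∧ ¬ HasFace t₁ {a, b} ∧
      ∀ c d, IsChord c d → (c, d) ≠ (a, b) → HasFace t {c, d} → HasFace t₁ {c, d} := by
  obtain ⟨v, z, t₁, ht₁, hv, hz, hm1, hm2, he⟩ :=
    (hp.isTriangulation_iff.1 ht).exists_flip h.lt h.not_covBy h.ne hf
  refine ⟨t₁, ⟨ht, hp.isTriangulation_iff.2 ht₁, a, v, b, z, hm1, hm2, he⟩, fun hcon => ?_, ?_⟩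
  · have := ht₁.onOneSide_of_hasFace h.lt hcon (τ := {a, v, z}) (by simp [he])
    unfold OnOneSide at this
    simp only [Finset.mem_insert, Finset.mem_singleton, forall_eq_or_imp, forall_eq] at this
    grind
  · rintro c d hcd hne ⟨σ, hσ, hs⟩
    have m1 : {a, v, z} ∈ t₁ := by simp [he]
    have m2 : {v, b, z} ∈ t₁ := by simp [he]
    have hlt := hcd.lt
    have hab := h.lt
    have hc : c ∈ σ := hs (by simp)
    have hd : d ∈ σ := hs (by simp)
    by_cases h1 : σ = {a, v, b}
    · subst h1
      simp only [Finset.mem_insert, Finset.mem_singleton] at hc hd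
      by_cases hca : c = a
      · exact ⟨_, m1, by grind⟩
      · exact ⟨_, m2, by grind⟩
    · by_cases h2 : σ = {a, b, z}
      · subst h2
        simp only [Finset.mem_insert, Finset.mem_singleton] at hc hd
        by_cases hca : c = a ∨ d = a
        · exact ⟨_, m1, by grind⟩
        · exact ⟨_, m2, by grind⟩
      · exact ⟨σ, by simp [he, hσ, h1, h2], hs⟩

/-- The fold coefficients of a function with respect to a triangulation. -/
theorem exists_fold_coeff (hp : IsConvexPolygon p) (ht : IsTriangulation p t)
    (ω : Fin (n + 3) → ℝ) : ∃ f, IsAffineFun f ∧ ∃ c : Fin (n + 3) × Fin (n + 3) → ℝ,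
      (∀ q, c q ≠ 0 → IsChord q.1 q.2 ∧ HasFace t {q.1, q.2}) ∧
      (∀ x, ω x = f (p x) + ∑ q, c q * fold p q.1 q.2 x) ∧
      (∀ t', IsTriangulation p t' → cellSum p ω t' - cellSum p ω t =
        ∑ q, c q * (cellSum p (fold p q.1 q.2) t' - cellSum p (fold p q.1 q.2) t)) := by
  obtain ⟨f, hf, c, hc, e⟩ := hp.exists_eq_affine_add_sum_fold (hp.isTriangulation_iff.1 ht) ω
  refine ⟨f, hf, c, fun q hq => ?_, e, fun t' ht' => ?_⟩
  · obtain ⟨h1, h2, h3, h4⟩ := hc q hq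
    exact ⟨⟨h1, h2, h3⟩, h4⟩
  · obtain ⟨k, hk⟩ := hp.exists_cellSum_affine hf 0 (Fin.last (n + 2))
    have key : ∀ t', IsTriangulation p t' →
        cellSum p ω t' = k + ∑ q, c q * cellSum p (fold p q.1 q.2) t' := by
      intro t' ht'
      rw [show ω = fun x => f (p x) + ∑ q, c q * fold p q.1 q.2 x from funext e, cellSum_add,
        hk t' (hp.isTriangulation_iff.1 ht'), cellSum_sum]
    rw [key t' ht', key t ht]
    simp only [mul_sub, Finset.sum_sub_distrib]
    ring

/-- A flip changes the value of a function by a positive multiple of its fold coefficient. -/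
theorem exists_isFlip_cellSum (hp : IsConvexPolygon p) (ht : IsTriangulation p t)
    {ω : Fin (n + 3) → ℝ} {c : Fin (n + 3) × Fin (n + 3) → ℝ}
    (hc : ∀ q, c q ≠ 0 → IsChord q.1 q.2 ∧ HasFace t {q.1, q.2})
    (hω : ∀ t', IsTriangulation p t' → cellSum p ω t' - cellSum p ω t =
        ∑ q, c q * (cellSum p (fold p q.1 q.2) t' - cellSum p (fold p q.1 q.2) t))
    (h : IsChord a b) (hf : HasFace t {a, b}) :
    ∃ t₁, IsFlip p t t₁ ∧ ¬ HasFace t₁ {a, b} ∧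
      (∀ c d, IsChord c d → (c, d) ≠ (a, b) → HasFace t {c, d} → HasFace t₁ {c, d}) ∧
      ∃ k > 0, cellSum p ω t₁ - cellSum p ω t = c (a, b) * k := by
  obtain ⟨t₁, hflip, hn, hkeep⟩ := hp.exists_isFlip h ht hf
  refine ⟨t₁, hflip, hn, hkeep, cellSum p (fold p a b) t₁ - cellSum p (fold p a b) t, ?_, ?_⟩
  · have := hp.cellSum_fold_le h ht hf hflip.2.1
    exact sub_pos.2 (lt_of_le_of_ne this.1 fun he => hn (this.2.1 he.symm))
  · rw [hω t₁ hflip.2.1, Finset.sum_eq_single (a, b)]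
    -- The other diagonals with nonzero coefficient survive the flip, so their folds stay at the
    -- minimum.
    · intro q _ hq
      by_cases hq0 : c q = 0
      · rw [hq0, zero_mul]
      · obtain ⟨h1, h2⟩ := hc q hq0
        rw [((hp.cellSum_fold_le h1 ht h2 hflip.2.1).2).2 (hkeep _ _ h1 hq h2), sub_self, mul_zero]
    · simp

/-- A function that is constant on the triangulations containing a diagonal is a multiple of the
fold along it, up to an affine function. -/
theorem eq_affine_add_fold_of_const (hp : IsConvexPolygon p) (h : IsChord a b)
    (ht : IsTriangulation p t) (hf : HasFace t {a, b}) {ω : Fin (n + 3) → ℝ}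
    (hω : ∀ t₁, IsFlip p t t₁ → HasFace t₁ {a, b} → cellSum p ω t₁ = cellSum p ω t) :
    ∃ f, IsAffineFun f ∧ ∃ k : ℝ, (∀ x, ω x = f (p x) + k * fold p a b x) ∧
      ∀ t', IsTriangulation p t' → cellSum p ω t' - cellSum p ω t =
        k * (cellSum p (fold p a b) t' - cellSum p (fold p a b) t) := by
  obtain ⟨f, haff, c, hc, e, hd⟩ := hp.exists_fold_coeff ht ω
  have hz : ∀ q, q ≠ (a, b) → c q = 0 := by
    intro q hq
    by_contra hq0
    obtain ⟨h1, h2⟩ := hc q hq0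
    obtain ⟨t₁, hflip, -, hkeep, k, hk, hval⟩ := hp.exists_isFlip_cellSum ht hc hd h1 h2
    rw [hω t₁ hflip (hkeep a b h (Ne.symm hq) hf), sub_self] at hval
    exact (mul_ne_zero hq0 hk.ne') hval.symm
  have hsum : ∀ g : Fin (n + 3) × Fin (n + 3) → ℝ, ∑ q, c q * g q = c (a, b) * g (a, b) :=
    fun g => Finset.sum_eq_single (a, b) (fun q _ hq => by rw [hz q hq, zero_mul]) (by simp)
  refine ⟨f, haff, c (a, b), fun x => ?_, fun t' ht' => ?_⟩
  · rw [e x, hsum fun q => fold p q.1 q.2 x]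
  · rw [hd t' ht', hsum fun q => cellSum p (fold p q.1 q.2) t' - cellSum p (fold p q.1 q.2) t]

/-- All minimizers of a nonconstant function contain a common diagonal. -/
theorem exists_chord_of_minimal (hp : IsConvexPolygon p) (ht : IsTriangulation p t)
    {ω : Fin (n + 3) → ℝ} (hmin : ∀ t', IsTriangulation p t' → cellSum p ω t ≤ cellSum p ω t')
    (hne : ∃ t', IsTriangulation p t' ∧ cellSum p ω t' ≠ cellSum p ω t) :
    ∃ a b, IsChord a b ∧ ∀ t', IsTriangulation p t' → cellSum p ω t' = cellSum p ω t →
      HasFace t' {a, b} := by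
  obtain ⟨f, -, c, hc, -, hd⟩ := hp.exists_fold_coeff ht ω
  have hnonneg : ∀ q, 0 ≤ c q := by
    intro q
    by_cases hq0 : c q = 0
    · exact hq0.ge
    · obtain ⟨h1, h2⟩ := hc q hq0
      obtain ⟨t₁, hflip, -, -, k, hk, hval⟩ := hp.exists_isFlip_cellSum ht hc hd h1 h2
      have := hmin t₁ hflip.2.1
      exact nonneg_of_mul_nonneg_left (by linarith) hk
  obtain ⟨q, hq⟩ : ∃ q, c q ≠ 0 := by
    by_contra! hcon
    obtain ⟨t', ht', hne⟩ := hne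
    have := hd t' ht'
    simp only [hcon, zero_mul, Finset.sum_const_zero] at this
    exact hne (sub_eq_zero.1 this)
  obtain ⟨hqc, hqf⟩ := hc q hq
  refine ⟨q.1, q.2, hqc, fun t' ht' he => ?_⟩
  have h0 := hd t' ht'
  rw [he, sub_self] at h0
  have hterm : ∀ r ∈ Finset.univ, 0 ≤ c r *
      (cellSum p (fold p r.1 r.2) t' - cellSum p (fold p r.1 r.2) t) := by
    intro r _
    by_cases hr : c r = 0
    · rw [hr, zero_mul]
    · obtain ⟨h1, h2⟩ := hc r hr
      exact mul_nonneg (hnonneg r) (sub_nonneg.2 (hp.cellSum_fold_le h1 ht h2 ht').1)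
  have := (Finset.sum_eq_zero_iff_of_nonneg hterm).1 h0.symm q (Finset.mem_univ q)
  have := (mul_eq_zero.1 this).resolve_left hq
  exact (hp.cellSum_fold_le hqc ht hqf ht').2.1 (sub_eq_zero.1 this)

/-- The folds along two crossing diagonals are independent modulo affine functions if the polygon
has a fifth vertex. -/
theorem not_fold_eq_affine_add_fold (hp : IsConvexPolygon p) (hn : 2 ≤ n) {c d u w : Fin (n + 3)}
    (hab : a < b) (hcd : c < d) (hu : a < u ∧ u < b) (hw : w < a ∨ b < w)
    (huw : ({u, w} : Finset (Fin (n + 3))) = {c, d}) {f : EuclideanSpace ℝ (Fin 2) → ℝ}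
    (hf : IsAffineFun f) (k : ℝ) (e : ∀ x, fold p a b x = f (p x) + k * fold p c d x) : False := by
  -- This is the only use of `2 ≤ n`: on the four vertices of a quadrilateral the two folds are
  -- dependent modulo affine functions.
  obtain ⟨v, hv⟩ : ∃ v, v ∉ ({a, b, u, w} : Finset (Fin (n + 3))) := by
    by_contra! hcon
    have h1 : Finset.univ ⊆ ({a, b, u, w} : Finset (Fin (n + 3))) := fun k _ => hcon k
    have h2 := (Finset.card_le_card h1).trans Finset.card_le_four
    simp at h2
    omega
  simp only [Finset.mem_insert, Finset.mem_singleton, not_or] at hv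
  obtain ⟨hva, hvb, hvu, hvw⟩ := hv
  have hcases : (u = c ∧ w = d) ∨ (u = d ∧ w = c) := by
    have h1 : u ∈ ({c, d} : Finset (Fin (n + 3))) := huw ▸ by simp
    have h2 : w ∈ ({c, d} : Finset (Fin (n + 3))) := huw ▸ by simp
    simp only [Finset.mem_insert, Finset.mem_singleton] at h1 h2
    grind
  -- On the closed side of `{c, d}` that contains `v` the fold along `{c, d}` is affine. So there
  -- the fold along `{a, b}` agrees with an affine `g` at `u`, `w`, `v` and the end `z` of `{a, b}`
  -- on that side.
  obtain ⟨g, hg, z, hz, gz, gv, gu, gw⟩ : ∃ g, IsAffineFun g ∧ ∃ z, (z = a ∨ z = b) ∧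
      fold p a b z = g (p z) ∧ fold p a b v = g (p v) ∧ fold p a b u = g (p u) ∧
      fold p a b w = g (p w) := by
    by_cases hvcd : c < v ∧ v < d
    · have hin : ∀ x, c ≤ x ∧ x ≤ d →
          fold p a b x = f (p x) + k * orient (p c) (p x) (p d) := fun x hx => by
        rw [e x, hp.fold_eq_orient hx]
      refine ⟨_, hf.add ((IsAffineFun.orient_middle (p c) (p d)).const_mul k), ?_⟩
      have hz : ∃ z, (z = a ∨ z = b) ∧ c ≤ z ∧ z ≤ d := by
        by_cases ha : c ≤ a ∧ a ≤ d
        · exact ⟨a, Or.inl rfl, ha⟩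
        · exact ⟨b, Or.inr rfl, by grind⟩
      obtain ⟨z, hz, hzcd⟩ := hz
      exact ⟨z, hz, hin z hzcd, hin v ⟨hvcd.1.le, hvcd.2.le⟩, hin u (by grind), hin w (by grind)⟩
    · have hout : ∀ x, ¬(c < x ∧ x < d) → fold p a b x = f (p x) := fun x hx => by
        rw [e x, hp.fold_eq_zero hcd hx, mul_zero, add_zero]
      refine ⟨f, hf, ?_⟩
      have hz : ∃ z, (z = a ∨ z = b) ∧ ¬(c < z ∧ z < d) := by
        by_cases ha : c < a ∧ a < d
        · exact ⟨b, Or.inr rfl, by grind⟩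
        · exact ⟨a, Or.inl rfl, ha⟩
      obtain ⟨z, hz, hzcd⟩ := hz
      exact ⟨z, hz, hout z hzcd, hout v hvcd, hout u (by grind), hout w (by grind)⟩
  have hzv : z ≠ v := by grind
  have hzu : z ≠ u := by grind
  have hzw : z ≠ w := by grind
  have sz : orient (p a) (p z) (p b) = 0 := by rcases hz with rfl | rfl <;> simp
  rw [hp.fold_eq_orient ⟨hu.1.le, hu.2.le⟩] at gu
  rw [hp.fold_eq_zero hab (by grind)] at gw
  rw [hp.fold_eq_zero hab (by grind)] at gz
  have su := hp.orient_pos hu.1 hu.2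
  have sw := hp.orient_neg hab hw
  -- Either way three of these vertices lie on one side of the crease and determine `g`; the fourth,
  -- strictly on the other side, contradicts it.
  by_cases hvab : a < v ∧ v < b
  · rw [hp.fold_eq_orient ⟨hvab.1.le, hvab.2.le⟩] at gv
    have := (hg.sub (IsAffineFun.orient_middle (p a) (p b))).eq_zero_of_three
      (hp.orient_ne_zero hzv hvu hzu) (by rw [← gz, sz, sub_zero]) (by rw [← gv, sub_self])
      (by rw [← gu, sub_self]) (p w)
    linarith
  · rw [hp.fold_eq_zero hab hvab] at gv
    have := hg.eq_zero_of_three (hp.orient_ne_zero hzv hvw hzw) gz.symm gv.symm gw.symm (p u)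
    linarith

end IsConvexPolygon

/-! ### Linear functionals on convex hulls -/

/-- The linear functional with coefficients `ω`. -/
def pairing {m : ℕ} (ω : Fin m → ℝ) : (Fin m → ℝ) →ₗ[ℝ] ℝ := ∑ i, ω i • LinearMap.proj i

theorem pairing_gkz {m : ℕ} (p : Fin m → EuclideanSpace ℝ (Fin 2)) (ω : Fin m → ℝ)
    (t : Finset (Finset (Fin m))) : pairing ω (gkz p t) = cellSum p ω t := by
  rw [← sum_mul_gkz]
  simp [pairing]

theorem exists_eq_pairing {m : ℕ} (l : (Fin m → ℝ) →ₗ[ℝ] ℝ) : ∃ ω, l = pairing ω := by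
  refine ⟨fun i => l (Pi.single i 1), ?_⟩
  ext i
  simp [pairing, Pi.single_apply]

section Linear

variable {E : Type*} [AddCommGroup E] [Module ℝ E]

theorem vectorSpan_convexHull (s : Set E) :
    vectorSpan ℝ (convexHull ℝ s) = vectorSpan ℝ s := by
  rw [← direction_affineSpan, affineSpan_convexHull, direction_affineSpan]

theorem vectorSpan_le_ker_iff {s : Set E} {φ : E →ₗ[ℝ] ℝ} :
    vectorSpan ℝ s ≤ LinearMap.ker φ ↔ ∀ x ∈ s, ∀ y ∈ s, φ x = φ y := by
  rw [vectorSpan_def, Submodule.span_le]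
  constructor
  · intro h x hx y hy
    have := h (Set.vsub_mem_vsub hx hy)
    rw [SetLike.mem_coe, LinearMap.mem_ker, vsub_eq_sub, map_sub, sub_eq_zero] at this
    exact this
  · rintro h _ ⟨x, hx, y, hy, rfl⟩
    simp [h x hx y hy]

theorem le_of_mem_convexHull {s : Set E} {φ : E →ₗ[ℝ] ℝ} {c : ℝ} (h : ∀ x ∈ s, c ≤ φ x) {x : E}
    (hx : x ∈ convexHull ℝ s) : c ≤ φ x :=
  convexHull_min (t := {x | c ≤ φ x}) h (convex_halfSpace_ge φ.isLinear c) hx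

/-- The points that satisfy the claim form a convex set: a combination with positive weights attains
the minimum only if both points do. -/
theorem mem_convexHull_of_eq_min {s : Set E} {φ : E →ₗ[ℝ] ℝ} {c : ℝ} (h : ∀ x ∈ s, c ≤ φ x)
    {x : E} (hx : x ∈ convexHull ℝ s) (hc : φ x = c) :
    x ∈ convexHull ℝ {y ∈ s | φ y = c} := by
  have hconv : Convex ℝ {x | c ≤ φ x ∧ (φ x = c → x ∈ convexHull ℝ {y ∈ s | φ y = c})} := by
    rintro x ⟨hx, hx'⟩ y ⟨hy, hy'⟩ a b ha hb hab
    refine ⟨convex_halfSpace_ge φ.isLinear c hx hy ha hb hab, fun he => ?_⟩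
    rw [map_add, map_smul, map_smul, smul_eq_mul, smul_eq_mul] at he
    rcases ha.eq_or_lt with rfl | ha0
    · have : b = 1 := by linarith
      subst this
      simp only [zero_mul, one_mul, zero_add] at he
      simpa using hy' he
    rcases hb.eq_or_lt with rfl | hb0
    · have : a = 1 := by linarith
      subst this
      simp only [zero_mul, one_mul, add_zero] at he
      simpa using hx' he
    have hca : a * c + b * c = c := by rw [← add_mul, hab, one_mul]
    have h1 : φ x = c := by
      by_contra hne
      have := mul_lt_mul_of_pos_left (lt_of_le_of_ne hx (Ne.symm hne)) ha0
      have := mul_le_mul_of_nonneg_left hy hb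
      linarith
    have h2 : φ y = c := by
      by_contra hne
      have := mul_lt_mul_of_pos_left (lt_of_le_of_ne hy (Ne.symm hne)) hb0
      have := mul_le_mul_of_nonneg_left hx ha
      linarith
    exact convex_convexHull ℝ _ (hx' h1) (hy' h2) ha hb hab
  have hsub : s ⊆ {x | c ≤ φ x ∧ (φ x = c → x ∈ convexHull ℝ {y ∈ s | φ y = c})} :=
    fun y hy => ⟨h y hy, fun hyc => subset_convexHull ℝ _ ⟨hy, hyc⟩⟩
  exact (convexHull_min hsub hconv hx).2 hc

theorem finrank_add_one_of_eq_inf_ker [FiniteDimensional ℝ E] {V W : Submodule ℝ E}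
    {φ : E →ₗ[ℝ] ℝ} (hW : W = V ⊓ LinearMap.ker φ) {v : E} (hv : v ∈ V) (hφ : φ v ≠ 0) :
    Module.finrank ℝ W + 1 = Module.finrank ℝ V := by
  have h1 := LinearMap.finrank_range_add_finrank_ker (φ.domRestrict V)
  have h2 : LinearMap.range (φ.domRestrict V) = ⊤ := by
    rw [LinearMap.range_eq_top]
    intro c
    refine ⟨(c / φ v) • ⟨v, hv⟩, ?_⟩
    rw [map_smul, LinearMap.domRestrict_apply, smul_eq_mul, div_mul_cancel₀ _ hφ]
  have h3 : W = (LinearMap.ker (φ.domRestrict V)).map V.subtype := by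
    rw [hW]
    ext x
    simp [and_comm]
  rw [h2, finrank_top, Module.finrank_self] at h1
  rw [h3, Submodule.finrank_map_subtype_eq]
  omega

end Linear

/-! ### The facets of the secondary polytope -/

namespace IsConvexPolygon

variable {n : ℕ} {p : Fin (n + 3) → EuclideanSpace ℝ (Fin 2)} {a b : Fin (n + 3)}
  {t t' : Finset (Finset (Fin (n + 3)))}

theorem gkz_mem_secondaryPolytope (ht : IsTriangulation p t) : gkz p t ∈ secondaryPolytope p :=
  subset_convexHull ℝ _ ⟨t, ht, rfl⟩

theorem gkz_mem_diagonalFace {δ : Finset (Fin (n + 3))} (ht : IsTriangulation p t)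
    (hf : HasFace t δ) : gkz p t ∈ diagonalFace p δ :=
  subset_convexHull ℝ _ ⟨t, ht, hf, rfl⟩

theorem diagonalFace_subset (δ : Finset (Fin (n + 3))) :
    diagonalFace p δ ⊆ secondaryPolytope p :=
  convexHull_mono fun _ ⟨t, ht, _, he⟩ => ⟨t, ht, he⟩

theorem diagonalFace_eq (hp : IsConvexPolygon p) (h : IsChord a b) (ht : IsTriangulation p t)
    (hf : HasFace t {a, b}) : diagonalFace p {a, b} =
      {x ∈ secondaryPolytope p | pairing (fold p a b) x = cellSum p (fold p a b) t} := by
  apply subset_antisymm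
  · refine fun x hx => ⟨diagonalFace_subset _ hx, ?_⟩
    refine convexHull_min (t := {x | pairing (fold p a b) x = cellSum p (fold p a b) t}) ?_
      (convex_hyperplane (pairing (fold p a b)).isLinear _) hx
    rintro _ ⟨t', ht', hf', rfl⟩
    rw [Set.mem_ofPred_eq, pairing_gkz]
    exact ((hp.cellSum_fold_le h ht hf ht').2).2 hf'
  · rintro x ⟨hx, hx0⟩
    have := mem_convexHull_of_eq_min (φ := pairing (fold p a b)) (fun y hy => by
      obtain ⟨t', ht', rfl⟩ := hy
      rw [pairing_gkz]
      exact (hp.cellSum_fold_le h ht hf ht').1) hx hx0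
    refine convexHull_mono ?_ this
    rintro _ ⟨⟨t', ht', rfl⟩, he⟩
    rw [pairing_gkz] at he
    exact ⟨t', ht', ((hp.cellSum_fold_le h ht hf ht').2).1 he, rfl⟩

theorem gkz_mem_diagonalFace_iff (hp : IsConvexPolygon p) (h : IsChord a b)
    (ht : IsTriangulation p t) : gkz p t ∈ diagonalFace p {a, b} ↔ HasFace t {a, b} := by
  obtain ⟨s, hs, hf⟩ := hp.exists_hasFace h
  rw [hp.diagonalFace_eq h hs hf, Set.mem_ofPred_eq, pairing_gkz,
    (hp.cellSum_fold_le h hs hf ht).2]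
  exact and_iff_right (gkz_mem_secondaryPolytope ht)

theorem vectorSpan_diagonalFace_le_ker (hp : IsConvexPolygon p) (h : IsChord a b) :
    vectorSpan ℝ (diagonalFace p {a, b}) ≤ LinearMap.ker (pairing (fold p a b)) := by
  obtain ⟨s, hs, hf⟩ := hp.exists_hasFace h
  rw [hp.diagonalFace_eq h hs hf]
  exact vectorSpan_le_ker_iff.2 fun x hx y hy => hx.2.trans hy.2.symm

/-- By duality: a functional that vanishes on the direction space of the face is constant on the
face, so on the polytope it is a multiple of the fold up to a constant, and it vanishes wherever the
fold does. -/
theorem vectorSpan_diagonalFace (hp : IsConvexPolygon p) (h : IsChord a b) :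
    vectorSpan ℝ (diagonalFace p {a, b}) =
      vectorSpan ℝ (secondaryPolytope p) ⊓ LinearMap.ker (pairing (fold p a b)) := by
  refine le_antisymm (le_inf (vectorSpan_mono ℝ (diagonalFace_subset _))
    (hp.vectorSpan_diagonalFace_le_ker h)) fun x hx => ?_
  by_contra hxn
  obtain ⟨l, hlx, hl⟩ := Submodule.exists_le_ker_of_notMem hxn
  obtain ⟨ω, rfl⟩ := exists_eq_pairing l
  rw [vectorSpan_le_ker_iff] at hl
  obtain ⟨t, ht, hf⟩ := hp.exists_hasFace h
  obtain ⟨-, -, k, -, hk⟩ := hp.eq_affine_add_fold_of_const h ht hf (ω := ω) fun t₁ ht₁ hf₁ => by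
    rw [← pairing_gkz, ← pairing_gkz]
    exact hl _ (gkz_mem_diagonalFace ht₁.2.1 hf₁) _ (gkz_mem_diagonalFace ht hf)
  have hker : vectorSpan ℝ (secondaryPolytope p) ≤
      LinearMap.ker (pairing ω - k • pairing (fold p a b)) := by
    rw [secondaryPolytope, vectorSpan_convexHull, vectorSpan_le_ker_iff]
    have key : ∀ t', IsTriangulation p t' → (pairing ω - k • pairing (fold p a b)) (gkz p t') =
        cellSum p ω t - k * cellSum p (fold p a b) t := fun t' ht' => by
      simp only [LinearMap.sub_apply, LinearMap.smul_apply, pairing_gkz, smul_eq_mul]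
      linarith [hk t' ht']
    rintro _ ⟨t', ht', rfl⟩ _ ⟨t'', ht'', rfl⟩
    rw [key t' ht', key t'' ht'']
  have h1 := hker hx.1
  have h2 := LinearMap.mem_ker.1 hx.2
  rw [LinearMap.mem_ker, LinearMap.sub_apply, LinearMap.smul_apply, h2, smul_zero, sub_zero] at h1
  exact hlx h1

theorem isFacet_diagonalFace (hp : IsConvexPolygon p) (h : IsChord a b) :
    IsFacet (secondaryPolytope p) (diagonalFace p {a, b}) := by
  obtain ⟨t, ht, hf⟩ := hp.exists_hasFace h
  -- Exposed faces are sets of maximizers, while folds are minimized; hence the sign.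
  refine ⟨fun _ => ⟨LinearMap.toContinuousLinearMap (-pairing (fold p a b)), ?_⟩,
    ⟨_, gkz_mem_diagonalFace ht hf⟩, ?_⟩
  · rw [hp.diagonalFace_eq h ht hf]
    have hmin : ∀ y ∈ secondaryPolytope p,
        cellSum p (fold p a b) t ≤ pairing (fold p a b) y := fun y hy =>
      le_of_mem_convexHull (fun z hz => by
        obtain ⟨t', ht', rfl⟩ := hz
        rw [pairing_gkz]
        exact (hp.cellSum_fold_le h ht hf ht').1) hy
    ext x
    simp only [Set.mem_ofPred_eq, LinearMap.coe_toContinuousLinearMap', LinearMap.neg_apply,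
      neg_le_neg_iff]
    refine and_congr_right fun hx => ⟨fun he y hy => he ▸ hmin y hy, fun hle => ?_⟩
    have := hle _ (gkz_mem_secondaryPolytope ht)
    rw [pairing_gkz] at this
    exact le_antisymm this (hmin x hx)
  -- Flipping the diagonal itself gives a direction of the polytope on which the fold is not zero.
  · obtain ⟨t₁, hflip, hn, -⟩ := hp.exists_isFlip h ht hf
    refine finrank_add_one_of_eq_inf_ker (hp.vectorSpan_diagonalFace h)
      (vsub_mem_vectorSpan ℝ (gkz_mem_secondaryPolytope hflip.2.1)
        (gkz_mem_secondaryPolytope ht)) ?_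
    rw [vsub_eq_sub, map_sub, pairing_gkz, pairing_gkz, sub_ne_zero]
    exact fun he => hn ((hp.cellSum_fold_le h ht hf hflip.2.1).2.1 he)

theorem exists_eq_diagonalFace (hp : IsConvexPolygon p) {F : Set (Fin (n + 3) → ℝ)}
    (hF : IsFacet (secondaryPolytope p) F) : ∃ a b, IsChord a b ∧ F = diagonalFace p {a, b} := by
  obtain ⟨l, hl⟩ := hF.isExposed hF.nonempty
  obtain ⟨x₀, hx₀⟩ := hF.nonempty
  obtain ⟨ω, hω⟩ := exists_eq_pairing (-(l : (Fin (n + 3) → ℝ) →ₗ[ℝ] ℝ))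
  have hlω : ∀ x, l x = -pairing ω x := fun x => by rw [← hω]; simp
  have hx₀' : x₀ ∈ secondaryPolytope p ∧ ∀ y ∈ secondaryPolytope p, l y ≤ l x₀ := by
    rwa [hl] at hx₀
  have hmin₀ : ∀ y ∈ secondaryPolytope p, pairing ω x₀ ≤ pairing ω y := fun y hy => by
    have := hx₀'.2 y hy
    rw [hlω, hlω] at this
    linarith
  have hF_eq : ∀ x, x ∈ F ↔ x ∈ secondaryPolytope p ∧ pairing ω x = pairing ω x₀ := by
    intro x
    rw [hl]
    refine and_congr_right fun hx => ⟨fun h => ?_, fun h y hy => ?_⟩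
    · have := h x₀ hx₀'.1
      rw [hlω, hlω] at this
      linarith [hmin₀ x hx]
    · rw [hlω, hlω, h]
      linarith [hmin₀ y hy]
  have hx₀S := mem_convexHull_of_eq_min (φ := pairing ω)
    (fun y hy => hmin₀ y (subset_convexHull ℝ _ hy)) hx₀'.1 rfl
  obtain ⟨_, ⟨t, ht, rfl⟩, htx⟩ := convexHull_nonempty_iff.1 ⟨_, hx₀S⟩
  rw [pairing_gkz] at htx
  have hmin : ∀ t', IsTriangulation p t' → cellSum p ω t ≤ cellSum p ω t' := fun t' ht' => by
    rw [htx, ← pairing_gkz]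
    exact hmin₀ _ (gkz_mem_secondaryPolytope ht')
  -- A facet is a proper face by its dimension, so the functional is not constant.
  have hne : ∃ t', IsTriangulation p t' ∧ cellSum p ω t' ≠ cellSum p ω t := by
    by_contra! hcon
    have hall : F = secondaryPolytope p := by
      ext x
      rw [hF_eq]
      refine and_iff_left_of_imp fun hx => ?_
      refine convexHull_min (t := {x | pairing ω x = pairing ω x₀}) ?_
        (convex_hyperplane (pairing ω).isLinear _) hx
      rintro _ ⟨t', ht', rfl⟩
      rw [Set.mem_ofPred_eq, pairing_gkz, hcon t' ht', htx]
    have := hF.finrank_add_one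
    rw [hall] at this
    omega
  obtain ⟨a, b, h, hab⟩ := hp.exists_chord_of_minimal ht hmin hne
  refine ⟨a, b, h, ?_⟩
  have hsub : F ⊆ diagonalFace p {a, b} := by
    intro x hx
    obtain ⟨hx1, hx2⟩ := (hF_eq x).1 hx
    have := mem_convexHull_of_eq_min (φ := pairing ω)
      (fun y hy => hmin₀ y (subset_convexHull ℝ _ hy)) hx1 hx2
    refine convexHull_mono ?_ this
    rintro _ ⟨⟨t', ht', rfl⟩, he⟩
    rw [pairing_gkz] at he
    exact ⟨t', ht', hab t' ht' (he.trans htx.symm), rfl⟩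
  -- Both sets are facets, one inside the other, so their direction spaces coincide and the
  -- functional is constant on the larger one too.
  have hspan : vectorSpan ℝ F = vectorSpan ℝ (diagonalFace p {a, b}) := by
    refine Submodule.eq_of_le_of_finrank_eq (vectorSpan_mono ℝ hsub) ?_
    have h1 := hF.finrank_add_one
    have h2 := (hp.isFacet_diagonalFace h).finrank_add_one
    omega
  refine subset_antisymm hsub fun y hy => (hF_eq y).2 ⟨diagonalFace_subset _ hy, ?_⟩
  have hker : vectorSpan ℝ F ≤ LinearMap.ker (pairing ω) := vectorSpan_le_ker_iff.2
    fun x hx y hy => ((hF_eq x).1 hx).2.trans ((hF_eq y).1 hy).2.symm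
  have := hker (hspan ▸ vsub_mem_vectorSpan ℝ hy (hsub hx₀))
  rw [LinearMap.mem_ker, vsub_eq_sub, map_sub, sub_eq_zero] at this
  exact this

/-- Equal faces would mean that the same triangulations contain both diagonals, but a flip removes
one and keeps the other. -/
theorem chord_eq_of_diagonalFace_eq (hp : IsConvexPolygon p) {c d : Fin (n + 3)}
    (h : IsChord a b) (h' : IsChord c d) (he : diagonalFace p {a, b} = diagonalFace p {c, d}) :
    (a, b) = (c, d) := by
  by_contra hne
  have key : ∀ t, IsTriangulation p t → (HasFace t {a, b} ↔ HasFace t {c, d}) := fun t ht => by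
    rw [← hp.gkz_mem_diagonalFace_iff h ht, ← hp.gkz_mem_diagonalFace_iff h' ht, he]
  obtain ⟨t, ht, hf⟩ := hp.exists_hasFace h
  obtain ⟨t₁, hflip, hn, hkeep⟩ := hp.exists_isFlip h' ht ((key t ht).1 hf)
  exact hn ((key t₁ hflip.2.1).1 (hkeep a b h hne hf))

theorem onOneSide_of_not_crosses (hp : IsConvexPolygon p) {c d : Fin (n + 3)} (h : IsChord a b)
    (hc : ¬ Crosses p {a, b} {c, d}) : OnOneSide a b {c, d} := by
  by_contra hcon
  apply hc
  unfold OnOneSide at hcon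
  simp only [Finset.mem_insert, Finset.mem_singleton, forall_eq_or_imp, forall_eq] at hcon
  have hlt := h.lt
  by_cases hin : a < c ∧ c < b
  · exact hp.crosses_of_alternating h.lt hin (by grind)
  · rw [Finset.pair_comm c d]
    exact hp.crosses_of_alternating h.lt (u := d) (by grind) (by grind)

/-- Some flip at a diagonal other than a given one moves the face of a crossing diagonal. -/
theorem exists_isFlip_notMem_vectorSpan (hp : IsConvexPolygon p) (hn : 2 ≤ n) {c d : Fin (n + 3)}
    (h : IsChord a b) (h' : IsChord c d) (hne : ({a, b} : Finset (Fin (n + 3))) ≠ {c, d})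
    (hc : Crosses p {a, b} {c, d}) :
    ∃ t t₁, IsFlip p t t₁ ∧ HasFace t {c, d} ∧ HasFace t₁ {c, d} ∧
      gkz p t₁ - gkz p t ∈ vectorSpan ℝ (diagonalFace p {c, d}) ∧
      gkz p t₁ - gkz p t ∉ vectorSpan ℝ (diagonalFace p {a, b}) := by
  obtain ⟨t, ht, hf⟩ := hp.exists_hasFace h'
  -- If no flip that keeps `{c, d}` changes the fold along `{a, b}`, then this fold is affine plus a
  -- multiple of the fold along `{c, d}`, which is impossible for crossing diagonals.
  by_cases hall : ∀ t₁, IsFlip p t t₁ → HasFace t₁ {c, d} →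
      cellSum p (fold p a b) t₁ = cellSum p (fold p a b) t
  · exfalso
    obtain ⟨f, haff, k, hk, -⟩ := hp.eq_affine_add_fold_of_const h' ht hf hall
    have hside : ¬ OnOneSide a b {c, d} := fun hs =>
      hp.not_crosses_of_onOneSide h.lt (Finset.card_pair h'.lt.ne) hne hs hc
    unfold OnOneSide at hside
    simp only [Finset.mem_insert, Finset.mem_singleton, forall_eq_or_imp, forall_eq] at hside
    have hlt := h.lt
    by_cases hin : a < c ∧ c < b
    · exact hp.not_fold_eq_affine_add_fold hn h.lt h'.lt hin (w := d) (by grind) rfl haff k hk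
    · exact hp.not_fold_eq_affine_add_fold hn h.lt h'.lt (u := d) (w := c) (by grind) (by grind)
        (Finset.pair_comm _ _) haff k hk
  · push Not at hall
    obtain ⟨t₁, hflip, hf₁, hval⟩ := hall
    refine ⟨t, t₁, hflip, hf, hf₁, vsub_mem_vectorSpan ℝ (gkz_mem_diagonalFace hflip.2.1 hf₁)
      (gkz_mem_diagonalFace ht hf), fun hmem => hval ?_⟩
    have := hp.vectorSpan_diagonalFace_le_ker h hmem
    rwa [LinearMap.mem_ker, map_sub, pairing_gkz, pairing_gkz, sub_eq_zero] at this

/-- For crossing diagonals the separating flip is already found. Otherwise flip `{c, d}` in a common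
triangulation: the difference lies in the direction space of the face of `{a, b}`, but the fold
along `{c, d}` does not vanish on it. -/
theorem chord_eq_of_vectorSpan_eq (hp : IsConvexPolygon p) (hn : 2 ≤ n) {c d : Fin (n + 3)}
    (h : IsChord a b) (h' : IsChord c d)
    (he : vectorSpan ℝ (diagonalFace p {a, b}) = vectorSpan ℝ (diagonalFace p {c, d})) :
    ({a, b} : Finset (Fin (n + 3))) = {c, d} := by
  by_contra hne
  by_cases hc : Crosses p {a, b} {c, d}
  · obtain ⟨t, t₁, -, -, -, h1, h2⟩ := hp.exists_isFlip_notMem_vectorSpan hn h h' hne hc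
    exact h2 (he ▸ h1)
  · obtain ⟨t, ht, hf, hf'⟩ := exists_polyTri_hasFace h h' (hp.onOneSide_of_not_crosses h hc)
    rw [← hp.isTriangulation_iff] at ht
    obtain ⟨t₁, hflip, hn₁, hkeep⟩ := hp.exists_isFlip h' ht hf'
    have hf₁ := hkeep a b h (fun heq => hne (by rw [(Prod.mk.inj heq).1, (Prod.mk.inj heq).2])) hf
    have hmem := vsub_mem_vectorSpan ℝ (gkz_mem_diagonalFace hflip.2.1 hf₁)
      (gkz_mem_diagonalFace ht hf)
    rw [he] at hmem
    have := hp.vectorSpan_diagonalFace_le_ker h' hmem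
    rw [LinearMap.mem_ker, vsub_eq_sub, map_sub, pairing_gkz, pairing_gkz, sub_eq_zero] at this
    exact hn₁ ((hp.cellSum_fold_le h' ht hf' hflip.2.1).2.1 this)

end IsConvexPolygon

end SecondaryPolytope

end

theorem theorem1 (n : ℕ) (hn : 2 ≤ n) (p : Fin (n + 3) → EuclideanSpace ℝ (Fin 2))
    (hp : SecondaryPolytope.IsConvexPolygon p) :
    -- the secondary polytope has no two parallel facets
    (∀ F F' : Set (Fin (n + 3) → ℝ),
      SecondaryPolytope.IsFacet (SecondaryPolytope.secondaryPolytope p) F →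
      SecondaryPolytope.IsFacet (SecondaryPolytope.secondaryPolytope p) F' →
      F ≠ F' → ¬ (affineSpan ℝ F).Parallel (affineSpan ℝ F')) ∧
    -- its facets are exactly the sets `F_δ`, one for each diagonal `δ`
    Set.BijOn (SecondaryPolytope.diagonalFace p)
      {δ | SecondaryPolytope.IsDiagonal δ}
      {F | SecondaryPolytope.IsFacet (SecondaryPolytope.secondaryPolytope p) F} ∧
    -- non-crossing diagonals give facets that intersect
    (∀ δ δ' : Finset (Fin (n + 3)),
      SecondaryPolytope.IsDiagonal δ → SecondaryPolytope.IsDiagonal δ' → δ ≠ δ' →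
      ¬ SecondaryPolytope.Crosses p δ δ' →
      (SecondaryPolytope.diagonalFace p δ ∩ SecondaryPolytope.diagonalFace p δ').Nonempty) ∧
    -- crossing diagonals are told apart by the difference of the GKZ vectors of a flip
    (∀ δ δ' : Finset (Fin (n + 3)),
      SecondaryPolytope.IsDiagonal δ → SecondaryPolytope.IsDiagonal δ' → δ ≠ δ' →
      SecondaryPolytope.Crosses p δ δ' →
      ∃ t t₁ : Finset (Finset (Fin (n + 3))),
        SecondaryPolytope.IsFlip p t t₁ ∧
        SecondaryPolytope.HasFace t δ' ∧ SecondaryPolytope.HasFace t₁ δ' ∧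
        SecondaryPolytope.gkz p t₁ - SecondaryPolytope.gkz p t ∈
          vectorSpan ℝ (SecondaryPolytope.diagonalFace p δ') ∧
        SecondaryPolytope.gkz p t₁ - SecondaryPolytope.gkz p t ∉
          vectorSpan ℝ (SecondaryPolytope.diagonalFace p δ)) := by
  refine ⟨fun F F' hF hF' hne hpar => ?_, ⟨fun δ hδ => ?_, fun δ hδ δ' hδ' he => ?_, fun F hF => ?_⟩,
    fun δ δ' hδ hδ' hne hc => ?_, fun δ δ' hδ hδ' hne hc => ?_⟩
  · obtain ⟨a, b, h, rfl⟩ := hp.exists_eq_diagonalFace hF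
    obtain ⟨c, d, h', rfl⟩ := hp.exists_eq_diagonalFace hF'
    have he := hpar.direction_eq
    rw [direction_affineSpan, direction_affineSpan] at he
    exact hne (by rw [hp.chord_eq_of_vectorSpan_eq hn h h' he])
  · obtain ⟨a, b, h, rfl⟩ := SecondaryPolytope.isDiagonal_iff.1 hδ
    exact hp.isFacet_diagonalFace h
  · obtain ⟨a, b, h, rfl⟩ := SecondaryPolytope.isDiagonal_iff.1 hδ
    obtain ⟨c, d, h', rfl⟩ := SecondaryPolytope.isDiagonal_iff.1 hδ'
    have := hp.chord_eq_of_diagonalFace_eq h h' he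
    rw [(Prod.mk.inj this).1, (Prod.mk.inj this).2]
  · obtain ⟨a, b, h, rfl⟩ := hp.exists_eq_diagonalFace hF
    exact ⟨{a, b}, SecondaryPolytope.isDiagonal_iff.2 ⟨a, b, h, rfl⟩, rfl⟩
  · obtain ⟨a, b, h, rfl⟩ := SecondaryPolytope.isDiagonal_iff.1 hδ
    obtain ⟨c, d, h', rfl⟩ := SecondaryPolytope.isDiagonal_iff.1 hδ'
    obtain ⟨t, ht, hf, hf'⟩ :=
      SecondaryPolytope.exists_polyTri_hasFace h h' (hp.onOneSide_of_not_crosses h hc)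
    rw [← hp.isTriangulation_iff] at ht
    exact ⟨_, SecondaryPolytope.IsConvexPolygon.gkz_mem_diagonalFace ht hf,
      SecondaryPolytope.IsConvexPolygon.gkz_mem_diagonalFace ht hf'⟩
  · obtain ⟨a, b, h, rfl⟩ := SecondaryPolytope.isDiagonal_iff.1 hδ
    obtain ⟨c, d, h', rfl⟩ := SecondaryPolytope.isDiagonal_iff.1 hδ'
    exact hp.exists_isFlip_notMem_vectorSpan hn h h' hne hc
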